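/- Let $k\ge 2$, $d\ge 2$, $n_0\ge 1$ and $n$ be integers. A (finite) hypergraph $\mathcal G=(V,E)$ consists of a finite vertex set $V$ and a set $E$ of non-empty subsets of $V$ (edges); it is $k$-uniform if every edge has exactly $k$ vertices. The degree $d(v)$ of a vertex is the number of edges containing it. A path of length $p$ is a sequence $(u_1,e_1,u_2,\dots,e_p,u_{p+1})$ of distinct vertices $u_i$ and distinct edges $e_i$ with $u_i,u_{i+1}\in e_i$ for all $i$; a cycle is such a sequence with $p\ge 2$ in which $u_1,\dots,u_p$ are distinct, $e_1,\dots,e_p$ are distinct and $u_{p+1}=u_1$. The distance $\mathrm{dist}(u,v)$ is the length of a shortest path from $u$ to $v$. A supertree is a connected hypergraph without cycles. Its boundary $\partial V$ is the set of vertices of degree $1$, and $V^\circ=V\setminus\partial V$ is the set of interior vertices. The Laplacian of $\mathcal G$ is $L_{\mathcal G}=D-A$, where $D$ is the diagonal matrix of the degrees and $A_{ij}=\sum_{e\in E,\ \{i,j\}\subseteq e}\frac1{|e|-1}$ for $i\ne j$, $A_{ii}=0$. A real number $\lambda$ is a Dirichlet eigenvalue of $\mathcal G$ if there is a function $f\neq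 0$ on $V$ with $L_{\mathcal G}f(u)=\lambda f(u)$ for $u\in V^\circ$ and $f(u)=0$ for $u\in\partial V$; the smallest one is the first Dirichlet eigenvalue $\lambda(\mathcal G)$. Let $\mathcal T^{n,n_0}$ be the class of $k$-uniform supertrees with $|V|=n$ and $|V^\circ|=n_0$, and let $\mathcal T^{n,n_0}_d$ be the class of those with $d(v)\ge d$ for all $v\in V^\circ$. A supertree has the Faber–Krahn property within $\mathcal T^{n,n_0}_d$ if it belongs to this class and its first Dirichlet eigenvalue is minimal in this class. For a supertree with root $v_0$ put $h(v)=\mathrm{dist}(v,v_0)$; a vertex $v$ is the parent of $u$ if $u,v$ are distinct, lie in a common edge and $h(u)=h(v)+1$. A well-ordering $\prec$ of the vertices is an SLO-ordering (spiral-like ordering) if (S1) $u\prec v$ implies $h(u)\le h(v)$; (S2) if $u$ is the parent of $u_1$, $v$ is the parent of $v_1$ and $u\prec v$, then $u_1\prec v_1$; (S3) if $u\prec v$ and $u\in\partial V$, then $v\in\partial V$; (S4) if $e=\{u_1,\dots,u_k\}$ is an edge with $u_1\prec\dots\prec u_k$, there is no vertex $v\notin e$ with $u_i\prec v\prec u_{i+1}$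 for some $2\le i\le k-1$; (S5) for $u,v\in V^\circ$, $u\prec v$ implies $d(u)\le d(v)$. A supertree is an SLO-supertree if it has an SLO-ordering for some choice of the root. Theorem. A supertree $\mathcal G\in\mathcal T^{n,n_0}$ has the Faber–Krahn property within the class $\mathcal T_d^{n,n_0}$ if and only if it is an SLO-supertree in which at most one interior vertex has degree greater than $d$, while all other interior vertices have degree $d$. If $\mathcal T_d^{n,n_0}$ is not empty, a supertree with the Faber–Krahn property within this class exists, and it is unique up to isomorphism. -/

import Mathlib

/-- A finite hypergraph on the vertex set `V`: a set of non-empty subsets of `V`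
(no multiple edges). -/
@[ext]
structure FinHypergraph (V : Type*) where
  /-- The edges. -/
  edges : Finset (Finset V)
  /-- Every edge is non-empty. -/
  nonempty_of_mem : ∀ e ∈ edges, e.Nonempty

namespace FinHypergraph

section Basic

variable {V : Type*}

/-- Every edge has exactly `k` vertices. -/
def IsUniform (G : FinHypergraph V) (k : ℕ) : Prop :=
  ∀ e ∈ G.edges, e.card = k

/-- Two distinct vertices are adjacent if they share an edge. -/
def Adj (G : FinHypergraph V) (u v : V) : Prop :=
  u ≠ v ∧ ∃ e ∈ G.edges, u ∈ e ∧ v ∈ e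

/-- `(u 0, e 0, u 1, e 1, …, e (p-1), u p)` is an alternating sequence of vertices and edges,
with `u i, u (i+1) ∈ e i` for every `i`. -/
def IsAlternating (G : FinHypergraph V) (p : ℕ) (u : Fin (p + 1) → V) (e : Fin p → Finset V) :
    Prop :=
  ∀ i : Fin p, e i ∈ G.edges ∧ u i.castSucc ∈ e i ∧ u i.succ ∈ e i

/-- A path of length `p`: the vertices are distinct and the edges are distinct. -/
def IsPath (G : FinHypergraph V) (p : ℕ) (u : Fin (p + 1) → V) (e : Fin p → Finset V) : Prop :=
  G.IsAlternating p u e ∧ Function.Injective u ∧ Function.Injective e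

/-- A cycle of length `p ≥ 2`: the edges are distinct, and the vertices are distinct except that
the last one is equal to the first one. -/
def IsCycle (G : FinHypergraph V) (p : ℕ) (u : Fin (p + 1) → V) (e : Fin p → Finset V) : Prop :=
  2 ≤ p ∧ G.IsAlternating p u e ∧ u 0 = u (Fin.last p) ∧
    Function.Injective (fun i : Fin p => u i.castSucc) ∧ Function.Injective e

/-- There is a path of length `p` from `a` to `b`. -/
def HasPath (G : FinHypergraph V) (a b : V) (p : ℕ) : Prop :=
  ∃ (u : Fin (p + 1) → V) (e : Fin p → Finset V),
    G.IsPath p u e ∧ u 0 = a ∧ u (Fin.last p) = b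

/-- Any two vertices are joined by a path. -/
def IsConnected (G : FinHypergraph V) : Prop :=
  Nonempty V ∧ ∀ a b : V, ∃ p, G.HasPath a b p

/-- There is no cycle. -/
def IsAcyclic (G : FinHypergraph V) : Prop :=
  ∀ (p : ℕ) (u : Fin (p + 1) → V) (e : Fin p → Finset V), ¬ G.IsCycle p u e

/-- A supertree is a connected and acyclic hypergraph. -/
def IsSupertree (G : FinHypergraph V) : Prop :=
  G.IsConnected ∧ G.IsAcyclic

/-- The distance of two vertices: the length of a shortest path that connects them. -/
noncomputable def dist (G : FinHypergraph V) (a b : V) : ℕ :=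
  sInf {p | G.HasPath a b p}

/-- Two hypergraphs are isomorphic if a bijection of the vertices carries edges to edges and
non-edges to non-edges. -/
def Isomorphic {W : Type*} (G : FinHypergraph V) (H : FinHypergraph W) : Prop :=
  ∃ σ : V ≃ W, ∀ e : Finset V, e.map σ.toEmbedding ∈ H.edges ↔ e ∈ G.edges

end Basic

section Degree

variable {V : Type*} [DecidableEq V]

/-- The degree of a vertex: the number of edges that contain it. -/
def degree (G : FinHypergraph V) (v : V) : ℕ :=
  (G.edges.filter fun e => v ∈ e).card

/-- The boundary vertices are the vertices of degree one. -/
def IsBoundary (G : FinHypergraph V) (v : V) : Prop :=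
  G.degree v = 1

/-- The interior vertices are the other ones. -/
def IsInterior (G : FinHypergraph V) (v : V) : Prop :=
  ¬ G.IsBoundary v

instance (G : FinHypergraph V) : DecidablePred G.IsBoundary :=
  fun v => inferInstanceAs (Decidable (G.degree v = 1))

instance (G : FinHypergraph V) : DecidablePred G.IsInterior :=
  fun v => inferInstanceAs (Decidable (¬ G.IsBoundary v))

end Degree

section Spectral

variable {V : Type*} [Fintype V] [DecidableEq V]

/-- The adjacency matrix; its entry at two distinct vertices `i`, `j` is the sum of
`1 / (|e| - 1)` over the edges `e` that contain both (zero if there are none), and its diagonal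
is zero. -/
noncomputable def adjMatrix (G : FinHypergraph V) : Matrix V V ℝ :=
  Matrix.of fun i j =>
    if i = j then 0
    else ∑ e ∈ G.edges.filter (fun e => i ∈ e ∧ j ∈ e), 1 / ((e.card : ℝ) - 1)

/-- The Laplacian matrix: the diagonal matrix of the degrees minus the adjacency matrix. -/
noncomputable def lapMatrix (G : FinHypergraph V) : Matrix V V ℝ :=
  Matrix.diagonal (fun v => (G.degree v : ℝ)) - G.adjMatrix

/-- `c` is a Dirichlet eigenvalue: some non-zero function `f` vanishes on the boundary and
satisfies `L f = c f` at the interior vertices. -/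
def IsDirichletEigenvalue (G : FinHypergraph V) (c : ℝ) : Prop :=
  ∃ f : V → ℝ, f ≠ 0 ∧
    (∀ v, G.IsInterior v → G.lapMatrix.mulVec f v = c * f v) ∧
    (∀ v, G.IsBoundary v → f v = 0)

/-- The first (smallest) Dirichlet eigenvalue. The Dirichlet eigenvalues form a finite set, which
is non-empty when there is an interior vertex, so that the infimum is then a minimum. -/
noncomputable def firstDirichletEigenvalue (G : FinHypergraph V) : ℝ :=
  sInf {c : ℝ | G.IsDirichletEigenvalue c}

/-- `G` has the Faber–Krahn property within the class `C`: it belongs to `C` and its first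
Dirichlet eigenvalue is minimal in `C`. -/
def HasFaberKrahn (C : Set (FinHypergraph V)) (G : FinHypergraph V) : Prop :=
  G ∈ C ∧ ∀ H ∈ C, G.firstDirichletEigenvalue ≤ H.firstDirichletEigenvalue

end Spectral

section SpiralLike

variable {V : Type*}

/-- In the supertree `G` with root `r`, the vertex `p` is the parent of `c` (and `c` a child of
`p`): they are adjacent and the height of `c` is one more than the height of `p`, where the height
of a vertex is its distance from the root. -/
def IsParent (G : FinHypergraph V) (r p c : V) : Prop :=
  G.Adj p c ∧ G.dist c r = G.dist p r + 1

/-- `lt` is a spiral-like ordering of the vertices of `G` with root `r`. -/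
structure IsSLOrdering [DecidableEq V] (G : FinHypergraph V) (r : V) (lt : V → V → Prop) :
    Prop where
  /-- `lt` is a well-ordering. -/
  wellOrder : IsWellOrder V lt
  /-- Heights are non-decreasing. -/
  height_le : ∀ u v, lt u v → G.dist u r ≤ G.dist v r
  /-- Children are ordered as their parents are. -/
  children : ∀ u v u₁ v₁, G.IsParent r u u₁ → G.IsParent r v v₁ → lt u v → lt u₁ v₁
  /-- Boundary vertices come after the interior vertices. -/
  boundary : ∀ u v, lt u v → G.IsBoundary u → G.IsBoundary v
  /-- The vertices of an edge, without the first one, are consecutive: no vertex outside of the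
  edge `e` lies between two vertices `b`, `c` of `e` that are not the first vertex of `e`. -/
  edge_consecutive : ∀ e ∈ G.edges, ∀ a ∈ e, ∀ b ∈ e, ∀ c ∈ e, lt a b → lt b c →
    ¬ ∃ v, v ∉ e ∧ lt b v ∧ lt v c
  /-- The degrees of the interior vertices are non-decreasing. -/
  degree_le : ∀ u v, G.IsInterior u → G.IsInterior v → lt u v → G.degree u ≤ G.degree v

/-- A hypergraph whose vertices have a spiral-like ordering for some choice of the root. -/
def HasSLOrdering [DecidableEq V] (G : FinHypergraph V) : Prop :=
  ∃ (r : V) (lt : V → V → Prop), G.IsSLOrdering r lt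

/-- At most one interior vertex has degree greater than `d`, and every other interior vertex has
degree `d`. -/
def AtMostOneInteriorDegreeGT [Fintype V] [DecidableEq V] (G : FinHypergraph V) (d : ℕ) : Prop :=
  (Finset.univ.filter fun v => G.IsInterior v ∧ d < G.degree v).card ≤ 1 ∧
    ∀ v, G.IsInterior v → ¬ d < G.degree v → G.degree v = d

end SpiralLike

/-- The `k`-uniform supertrees with `n` vertices and `n₀` interior vertices. -/
def supertrees (k n n₀ : ℕ) : Set (FinHypergraph (Fin n)) :=
  {G | G.IsUniform k ∧ G.IsSupertree ∧ (Finset.univ.filter fun v => G.IsInterior v).card = n₀}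

/-- The `k`-uniform supertrees with `n` vertices and `n₀` interior vertices all of whose interior
vertices have degree at least `d`. -/
def supertreesMinDegree (k n n₀ d : ℕ) : Set (FinHypergraph (Fin n)) :=
  {G | G ∈ supertrees k n n₀ ∧ ∀ v, G.IsInterior v → d ≤ G.degree v}

end FinHypergraph

/-!
Multiplied by `k - 1`, the Dirichlet form of a `k`-uniform hypergraph is the sum over the edges `e`
of `k * ∑ v ∈ e, f v ^ 2 - (∑ v ∈ e, f v) ^ 2`, so that only the sums of `f` over the edges matter
when edges are changed and the degrees are kept. Let `G` be a minimiser and `f` its positive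
eigenfunction, and take a maximum of `f` as the root. Two changes stay within the class:
exchanging vertices between two edges (switching) and moving an edge from a vertex to another one
(shifting). Neither can lower the Rayleigh quotient of `f`, and when it is kept, `f` is still an
eigenfunction. Therefore a vertex closer to the root has a value at least as large, and sorting the
children of each vertex by the sums of `f` over their parent edges and then by `f` gives a spiral
order along which `f` is non-increasing. If an interior vertex other than the last one had degree
greater than `d`, its last child edge could be shifted to the next interior vertex.

Conversely, in a spiral order the edges, each without its top vertex, occupy consecutive blocks of
`k - 1` positions, and the degrees of the earlier vertices determine the parent of each block. The
degrees being prescribed, two such supertrees are isomorphic. In particular each of them is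
isomorphic to a minimiser, which exists because there are finitely many hypergraphs on `n` vertices.
-/

namespace FinHypergraph

section TwoSection

variable {V : Type*}

/-- The 2-section of a family `F` of finite sets: the graph in which two distinct vertices are
adjacent if some member of `F` contains both. It reduces connectedness and distances in a
hypergraph to those in a graph. It is defined for families of edges because the arguments on
acyclicity delete and shrink edges. -/
def twoSection (F : Finset (Finset V)) : SimpleGraph V where
  Adj x y := x ≠ y ∧ ∃ e ∈ F, x ∈ e ∧ y ∈ e
  symm := ⟨fun _ _ ⟨hne, e, he, hx, hy⟩ => ⟨hne.symm, e, he, hy, hx⟩⟩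
  loopless := ⟨fun _ h => h.1 rfl⟩

namespace twoSection

variable {F F' : Finset (Finset V)} {e : Finset V} {x y z : V}

theorem mono (h : F ⊆ F') : twoSection F ≤ twoSection F' :=
  fun _ _ ⟨hne, e, he, hxy⟩ => ⟨hne, e, h he, hxy⟩

theorem reachable_of_mem (he : e ∈ F) (hx : x ∈ e) (hy : y ∈ e) :
    (twoSection F).Reachable x y := by
  by_cases hxy : x = y
  · rw [hxy]
  · exact SimpleGraph.Adj.reachable ⟨hxy, e, he, hx, hy⟩

theorem reachable_of_forall_mem
    (h : ∀ e ∈ F, ∀ x ∈ e, ∀ y ∈ e, (twoSection F').Reachable x y)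
    (hxy : (twoSection F).Reachable x y) : (twoSection F').Reachable x y := by
  obtain ⟨w⟩ := hxy
  induction w with
  | nil => rfl
  | cons hadj _ ih =>
    obtain ⟨-, e, he, hx, hy⟩ := hadj
    exact (h e he _ hx _ hy).trans ih

theorem dist_le_one (he : e ∈ F) (hx : x ∈ e) (hy : y ∈ e) : (twoSection F).dist x y ≤ 1 := by
  by_cases hxy : x = y
  · simp [hxy]
  · have hadj : (twoSection F).Adj x y := ⟨hxy, e, he, hx, hy⟩
    exact (SimpleGraph.dist_eq_one_iff_adj.2 hadj).le

theorem dist_le_succ (he : e ∈ F) (hx : x ∈ e) (hy : y ∈ e) :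
    (twoSection F).dist x z ≤ (twoSection F).dist y z + 1 := by
  have htriangle := (reachable_of_mem he hx hy).dist_triangle_left z
  have hone := dist_le_one he hx hy
  omega

theorem exists_mem_dist_eq_succ (h : (twoSection F).Reachable x z) (hne : x ≠ z) :
    ∃ e ∈ F, x ∈ e ∧ ∃ y ∈ e, (twoSection F).dist x z = (twoSection F).dist y z + 1 := by
  obtain ⟨w, hw⟩ := h.exists_walk_length_eq_dist
  cases w with
  | nil => exact absurd rfl hne
  | cons hadj w =>
    rw [SimpleGraph.Walk.length_cons] at hw
    obtain ⟨-, e, he, hx, hy⟩ := id hadj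
    refine ⟨e, he, hx, _, hy, le_antisymm (dist_le_succ he hx hy) ?_⟩
    rw [← hw]
    exact Nat.succ_le_succ (SimpleGraph.dist_le w)

theorem exists_path (h : (twoSection F).Reachable x y) :
    ∃ (u : Fin ((twoSection F).dist x y + 1) → V) (e : Fin ((twoSection F).dist x y) → Finset V),
      (∀ i, e i ∈ F ∧ u i.castSucc ∈ e i ∧ u i.succ ∈ e i) ∧
      u 0 = x ∧ u (Fin.last _) = y ∧ Function.Injective u ∧ Function.Injective e := by
  obtain ⟨w, hw⟩ := h.exists_walk_length_eq_dist
  have hdist : ∀ i, (twoSection F).dist (w.getVert i) y = w.length - i := fun i => by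
    rw [← SimpleGraph.length_eq_dist_of_subwalk hw (w.isSubwalk_drop i),
      SimpleGraph.Walk.drop_length]
  rw [← hw]
  choose e he hleft hright using fun i : Fin w.length => (w.adj_getVert_succ i.2).2
  -- An edge used twice would shortcut the geodesic.
  have hle : ∀ i j, e i = e j → i ≤ j := fun i j hij => by
    have hshort := dist_le_succ (z := y) (he j) (hleft j) (hij ▸ hright i)
    rw [hdist, hdist] at hshort
    omega
  refine ⟨fun i => w.getVert i, e, fun i => ⟨he i, hleft i, hright i⟩, w.getVert_zero,
    w.getVert_length, fun i j hij => ?_,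
    fun i j hij => le_antisymm (hle i j hij) (hle j i hij.symm)⟩
  have hi := hdist i
  have hj := hdist j
  rw [show w.getVert i = w.getVert j from hij] at hi
  omega

theorem reachable_and_dist_le_of_alternating {p : ℕ} {u : Fin (p + 1) → V} {e : Fin p → Finset V}
    (h : ∀ i : Fin p, e i ∈ F ∧ u i.castSucc ∈ e i ∧ u i.succ ∈ e i) (i : Fin (p + 1)) :
    (twoSection F).Reachable (u i) (u 0) ∧ (twoSection F).dist (u i) (u 0) ≤ i := by
  induction i using Fin.induction with
  | zero => simp
  | succ j ih =>
    obtain ⟨he, hleft, hright⟩ := h j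
    refine ⟨(reachable_of_mem he hright hleft).trans ih.1, ?_⟩
    exact (dist_le_succ he hright hleft).trans (Nat.succ_le_succ ih.2)

theorem reachable_filter_dist_lt {r : V} (h : ∀ v, (twoSection F).Reachable v r) (v : V) :
    (twoSection (F.filter fun e =>
      ∃ w ∈ e, (twoSection F).dist w r < (twoSection F).dist v r)).Reachable v r := by
  induction hm : (twoSection F).dist v r generalizing v with
  | zero => rw [(h v).dist_eq_zero_iff.1 hm]
  | succ m ih =>
    have hne : v ≠ r := by rintro rfl; simp at hm
    obtain ⟨e, he, hv, y, hy, hd⟩ := exists_mem_dist_eq_succ (h v) hne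
    have hym : (twoSection F).dist y r = m := by omega
    refine (reachable_of_mem (Finset.mem_filter.2 ⟨he, y, hy, by omega⟩) hv hy).trans
      ((ih y hym).mono (mono ?_))
    exact Finset.monotone_filter_right _ fun _ _ ⟨w, hw, hlt⟩ => ⟨w, hw, by omega⟩

theorem reachable_erase_of_forall_dist_le [DecidableEq V] {r : V}
    (h : ∀ v, (twoSection F).Reachable v r)
    (hx : ∀ w ∈ e, (twoSection F).dist x r ≤ (twoSection F).dist w r) :
    (twoSection (F.erase e)).Reachable x r := by
  refine (reachable_filter_dist_lt h x).mono (mono fun e' he' => ?_)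
  obtain ⟨hmem, w, hw, hlt⟩ := Finset.mem_filter.1 he'
  refine Finset.mem_erase.2 ⟨?_, hmem⟩
  rintro rfl
  exact (hx w hw).not_gt hlt

end twoSection

end TwoSection

section Supertree

variable {V : Type*} {G : FinHypergraph V}

theorem hasPath_of_reachable {a b : V} (h : (twoSection G.edges).Reachable a b) :
    G.HasPath a b ((twoSection G.edges).dist a b) := by
  obtain ⟨u, e, halt, hfirst, hlast, hu, he⟩ := twoSection.exists_path h
  exact ⟨u, e, ⟨halt, hu, he⟩, hfirst, hlast⟩

theorem HasPath.reachable {a b : V} {p : ℕ} (h : G.HasPath a b p) :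
    (twoSection G.edges).Reachable a b := by
  obtain ⟨u, e, ⟨halt, -, -⟩, rfl, rfl⟩ := h
  exact (twoSection.reachable_and_dist_le_of_alternating halt _).1.symm

theorem HasPath.dist_le {a b : V} {p : ℕ} (h : G.HasPath a b p) :
    (twoSection G.edges).dist a b ≤ p := by
  obtain ⟨u, e, ⟨halt, -, -⟩, rfl, rfl⟩ := h
  rw [SimpleGraph.dist_comm]
  exact (twoSection.reachable_and_dist_le_of_alternating halt (Fin.last p)).2

theorem IsConnected.reachable (h : G.IsConnected) (a b : V) :
    (twoSection G.edges).Reachable a b :=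
  (h.2 a b).choose_spec.reachable

theorem isConnected_of_reachable [Nonempty V]
    (h : ∀ a b, (twoSection G.edges).Reachable a b) : G.IsConnected :=
  ⟨‹_›, fun a b => ⟨_, hasPath_of_reachable (h a b)⟩⟩

theorem IsConnected.dist_eq (h : G.IsConnected) (a b : V) :
    G.dist a b = (twoSection G.edges).dist a b :=
  le_antisymm (Nat.sInf_le (hasPath_of_reachable (h.reachable a b)))
    (HasPath.dist_le (Nat.sInf_mem (h.2 a b)))

variable [DecidableEq V]

theorem IsAcyclic.not_reachable_erase (h : G.IsAcyclic) {e : Finset V} (he : e ∈ G.edges)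
    {x y : V} (hx : x ∈ e) (hy : y ∈ e) (hxy : x ≠ y) :
    ¬ (twoSection (G.edges.erase e)).Reachable x y := by
  intro hr
  have hpos := hr.pos_dist_of_ne hxy
  obtain ⟨u, c, halt, hfirst, hlast, hu, hc⟩ := twoSection.exists_path hr
  have hce : ∀ i, c i ≠ e := fun i => Finset.ne_of_mem_erase (halt i).1
  refine h _ (Fin.snoc u x : Fin (_ + 1 + 1) → V) (Fin.snoc c e : Fin (_ + 1) → Finset V)
    ⟨Nat.succ_le_succ hpos, ?_, ?_, ?_, Fin.snoc_injective_iff.2 ⟨hc, ?_⟩⟩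
  · refine Fin.lastCases ?_ fun i => ?_
    · simpa [hlast] using ⟨he, hy, hx⟩
    · simpa only [Fin.snoc_castSucc, Fin.succ_castSucc] using
        ⟨Finset.mem_of_mem_erase (halt i).1, (halt i).2⟩
  · rw [← Fin.castSucc_zero, Fin.snoc_castSucc, Fin.snoc_last, hfirst]
  · simpa only [Fin.snoc_castSucc] using hu
  · rintro ⟨i, hi⟩
    exact hce i hi

theorem isAcyclic_of_not_reachable_erase
    (h : ∀ e ∈ G.edges, ∀ x ∈ e, ∀ y ∈ e, x ≠ y →
      ¬ (twoSection (G.edges.erase e)).Reachable x y) :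
    G.IsAcyclic := by
  rintro p u e ⟨hp, halt, hclosed, hu, he⟩
  obtain ⟨q, rfl⟩ : ∃ q, p = q + 1 := ⟨p - 1, by omega⟩
  have hreach : ∀ i : Fin (q + 1),
      (twoSection (G.edges.erase (e 0))).Reachable (u 1) (u i.succ) := by
    intro i
    induction i using Fin.induction with
    | zero => rfl
    | succ j ih =>
      obtain ⟨hmem, hleft, hright⟩ := halt j.succ
      have hne : e j.succ ≠ e 0 := fun heq => Fin.succ_ne_zero j (he heq)
      exact ih.trans (twoSection.reachable_of_mem (Finset.mem_erase.2 ⟨hne, hmem⟩) hleft hright)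
  obtain ⟨hmem, hleft, hright⟩ := halt 0
  refine h _ hmem (u 0) hleft (u 1) hright (fun heq => ?_) ?_
  · have h01 : (0 : Fin (q + 1)) = ⟨1, by omega⟩ := hu (by simpa [Fin.ext_iff] using heq)
    simp [Fin.ext_iff] at h01
  · rw [hclosed, ← Fin.succ_last]
    exact (hreach (Fin.last q)).symm

theorem IsAcyclic.eq_of_mem_of_reachable (h : G.IsAcyclic) {e₁ e₂ : Finset V}
    (h₁ : e₁ ∈ G.edges) (h₂ : e₂ ∈ G.edges) (hne : e₁ ≠ e₂) {x₁ x₂ : V} (hx₁ : x₁ ∈ e₁)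
    (hx₂ : x₂ ∈ e₂) (hr : (twoSection ((G.edges.erase e₁).erase e₂)).Reachable x₁ x₂) {c : V}
    (hc₁ : c ∈ e₁) (hc₂ : c ∈ e₂) : c = x₁ := by
  by_contra hc
  refine h.not_reachable_erase h₁ hc₁ hx₁ hc ?_
  have hcx : (twoSection (G.edges.erase e₁)).Reachable c x₂ :=
    twoSection.reachable_of_mem (Finset.mem_erase.2 ⟨hne.symm, h₂⟩) hc₂ hx₂
  exact hcx.trans (hr.mono (twoSection.mono (Finset.erase_subset _ _))).symm

end Supertree

section Rooting

variable {V : Type*}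

/-- The hierarchy of a supertree with root `r`: every edge `e` has a vertex `top e`, the parent in
`G` of all its other vertices, and every vertex `v` other than the root has a unique edge
`parentEdge v` that leads towards the root. The height of `v` is `G.dist v r`. -/
structure Rooting (G : FinHypergraph V) (r : V) where
  /-- The vertex of smallest height of an edge. -/
  top : Finset V → V
  /-- The edge that contains a vertex and its parent. -/
  parentEdge : V → Finset V
  dist_eq_zero_iff : ∀ v, G.dist v r = 0 ↔ v = r
  top_mem : ∀ e ∈ G.edges, top e ∈ e
  dist_eq_succ : ∀ e ∈ G.edges, ∀ v ∈ e, v ≠ top e → G.dist v r = G.dist (top e) r + 1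
  parentEdge_mem : ∀ v, v ≠ r → parentEdge v ∈ G.edges
  mem_parentEdge : ∀ v, v ≠ r → v ∈ parentEdge v
  ne_top_parentEdge : ∀ v, v ≠ r → v ≠ top (parentEdge v)
  eq_parentEdge : ∀ e ∈ G.edges, ∀ v ∈ e, v ≠ top e → e = parentEdge v

variable {G : FinHypergraph V} {r : V}

theorem IsSupertree.dist_eq_succ (hG : G.IsSupertree) {e : Finset V} (he : e ∈ G.edges)
    {t v : V} (ht : t ∈ e) (hmin : ∀ w ∈ e, G.dist t r ≤ G.dist w r) (hv : v ∈ e) (hvt : v ≠ t) :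
    G.dist v r = G.dist t r + 1 := by
  classical
  simp only [hG.1.dist_eq] at hmin ⊢
  have hreach := fun v => hG.1.reachable v r
  refine le_antisymm (twoSection.dist_le_succ he hv ht) ?_
  by_contra! hlt
  have hvmin : ∀ w ∈ e, (twoSection G.edges).dist v r ≤ (twoSection G.edges).dist w r :=
    fun w hw => (Nat.le_of_lt_succ hlt).trans (hmin w hw)
  exact hG.2.not_reachable_erase he hv ht hvt
    ((twoSection.reachable_erase_of_forall_dist_le hreach hvmin).trans
      (twoSection.reachable_erase_of_forall_dist_le hreach hmin).symm)

theorem IsSupertree.edge_eq_of_dist_lt (hG : G.IsSupertree) {e e' : Finset V} (he : e ∈ G.edges)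
    (he' : e' ∈ G.edges) {v t t' : V} (hv : v ∈ e) (hv' : v ∈ e') (ht : t ∈ e) (ht' : t' ∈ e')
    (hmin : ∀ w ∈ e, G.dist t r ≤ G.dist w r) (hvt : v ≠ t)
    (hle : G.dist t' r ≤ G.dist t r) : e = e' := by
  classical
  simp only [hG.1.dist_eq] at hmin hle
  by_contra hne
  have hreach := fun v => hG.1.reachable v r
  have hvt' : (twoSection (G.edges.erase e)).Reachable v t' :=
    twoSection.reachable_of_mem (Finset.mem_erase.2 ⟨Ne.symm hne, he'⟩) hv' ht'
  have ht'r := twoSection.reachable_erase_of_forall_dist_le hreach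
    fun w hw => hle.trans (hmin w hw)
  have htr := twoSection.reachable_erase_of_forall_dist_le hreach hmin
  exact hG.2.not_reachable_erase he hv ht hvt (hvt'.trans (ht'r.trans htr.symm))

theorem IsSupertree.nonempty_rooting (hG : G.IsSupertree) (r : V) : Nonempty (G.Rooting r) := by
  have hzero : ∀ v, G.dist v r = 0 ↔ v = r := fun v => by
    rw [hG.1.dist_eq, (hG.1.reachable v r).dist_eq_zero_iff]
  have hmin : ∀ e, ∃ t, e ∈ G.edges → t ∈ e ∧ ∀ w ∈ e, G.dist t r ≤ G.dist w r := fun e => by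
    by_cases he : e ∈ G.edges
    · obtain ⟨t, ht⟩ := e.exists_min_image (G.dist · r) (G.nonempty_of_mem e he)
      exact ⟨t, fun _ => ht⟩
    · exact ⟨r, fun h => absurd h he⟩
  choose top htop using hmin
  have hdist : ∀ e ∈ G.edges, ∀ v ∈ e, v ≠ top e → G.dist v r = G.dist (top e) r + 1 :=
    fun e he v hv hne => hG.dist_eq_succ he (htop e he).1 (htop e he).2 hv hne
  have hedge : ∀ v, ∃ e, v ≠ r → e ∈ G.edges ∧ v ∈ e ∧ v ≠ top e := fun v => by
    by_cases hv : v = r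
    · exact ⟨∅, fun h => absurd hv h⟩
    · obtain ⟨e, he, hve, y, hy, hlt⟩ := twoSection.exists_mem_dist_eq_succ (hG.1.reachable v r) hv
      rw [← hG.1.dist_eq, ← hG.1.dist_eq] at hlt
      refine ⟨e, fun _ => ⟨he, hve, fun heq => ?_⟩⟩
      have := (htop e he).2 y hy
      rw [← heq] at this
      omega
  choose parentEdge hparent using hedge
  refine ⟨⟨top, parentEdge, hzero, fun e he => (htop e he).1, hdist, fun v hv => (hparent v hv).1,
    fun v hv => (hparent v hv).2.1, fun v hv => (hparent v hv).2.2, fun e he v hv hne => ?_⟩⟩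
  have hvr : v ≠ r := fun h => by
    have := hdist e he v hv hne
    rw [(hzero v).2 h] at this
    omega
  obtain ⟨he', hv', hne'⟩ := hparent v hvr
  refine hG.edge_eq_of_dist_lt he he' hv hv' (htop e he).1 (htop _ he').1 (htop e he).2 hne ?_
  have := hdist e he v hv hne
  have := hdist _ he' v hv' hne'
  omega

namespace Rooting

theorem dist_top_le (R : G.Rooting r) {e : Finset V} (he : e ∈ G.edges) {v : V} (hv : v ∈ e) :
    G.dist (R.top e) r ≤ G.dist v r := by
  by_cases hne : v = R.top e
  · rw [hne]
  · exact (R.dist_eq_succ e he v hv hne).ge.trans' (Nat.le_succ _)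

theorem ne_root_of_ne_top (R : G.Rooting r) {e : Finset V} (he : e ∈ G.edges) {v : V}
    (hv : v ∈ e) (hne : v ≠ R.top e) : v ≠ r := by
  intro hvr
  have := R.dist_eq_succ e he v hv hne
  rw [(R.dist_eq_zero_iff v).2 hvr] at this
  omega

theorem dist_eq_dist_parent_succ (R : G.Rooting r) {v : V} (hv : v ≠ r) :
    G.dist v r = G.dist (R.top (R.parentEdge v)) r + 1 :=
  R.dist_eq_succ _ (R.parentEdge_mem v hv) v (R.mem_parentEdge v hv) (R.ne_top_parentEdge v hv)

theorem eq_top_of_ne_parentEdge (R : G.Rooting r) {e : Finset V} (he : e ∈ G.edges) {v : V}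
    (hv : v ∈ e) (hne : e ≠ R.parentEdge v) : v = R.top e :=
  not_imp_comm.1 (R.eq_parentEdge e he v hv) hne

theorem top_parentEdge_mem (R : G.Rooting r) {v : V} (hv : v ≠ r) :
    R.top (R.parentEdge v) ∈ R.parentEdge v :=
  R.top_mem _ (R.parentEdge_mem v hv)

theorem reachable_root (R : G.Rooting r) (v : V) :
    (twoSection (G.edges.filter fun e => G.dist (R.top e) r < G.dist v r)).Reachable v r := by
  induction hm : G.dist v r generalizing v with
  | zero => rw [(R.dist_eq_zero_iff v).1 hm]
  | succ m ih =>
    have hne : v ≠ r := fun hv => by simp [(R.dist_eq_zero_iff v).2 hv] at hm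
    have hparent := R.dist_eq_dist_parent_succ hne
    refine (twoSection.reachable_of_mem (Finset.mem_filter.2 ⟨R.parentEdge_mem v hne, by omega⟩)
      (R.mem_parentEdge v hne) (R.top_parentEdge_mem hne)).trans
      ((ih _ (by omega)).mono (twoSection.mono ?_))
    exact Finset.monotone_filter_right _ fun e _ (he : _ < m) => Nat.lt_succ_of_lt he

theorem isParent_iff (R : G.Rooting r) {p c : V} :
    G.IsParent r p c ↔ c ≠ r ∧ p = R.top (R.parentEdge c) := by
  constructor
  · rintro ⟨⟨-, e, he, hp, hc⟩, hd⟩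
    have hct : c ≠ R.top e := fun h => by
      have := R.dist_top_le he hp
      rw [← h] at this
      omega
    have hcr := R.ne_root_of_ne_top he hc hct
    obtain rfl := R.eq_parentEdge e he c hc hct
    refine ⟨hcr, ?_⟩
    by_contra hpt
    have := R.dist_eq_succ _ he p hp hpt
    have := R.dist_eq_dist_parent_succ hcr
    omega
  · rintro ⟨hc, rfl⟩
    exact ⟨⟨(R.ne_top_parentEdge c hc).symm, _, R.parentEdge_mem c hc, R.top_parentEdge_mem hc,
      R.mem_parentEdge c hc⟩, R.dist_eq_dist_parent_succ hc⟩

end Rooting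

end Rooting

section EdgeCount

variable {V : Type*}

theorem Rooting.filter_parentEdge_eq [Fintype V] [DecidableEq V] {G : FinHypergraph V} {r : V}
    (R : G.Rooting r) {e : Finset V} (he : e ∈ G.edges) :
    (Finset.univ.erase r).filter (fun v => R.parentEdge v = e) = e.erase (R.top e) := by
  ext v
  simp only [Finset.mem_filter, Finset.mem_erase, Finset.mem_univ, and_true]
  constructor
  · rintro ⟨hv, rfl⟩
    exact ⟨R.ne_top_parentEdge v hv, R.mem_parentEdge v hv⟩
  · rintro ⟨hne, hv⟩
    exact ⟨R.ne_root_of_ne_top he hv hne, (R.eq_parentEdge e he v hv hne).symm⟩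

theorem IsSupertree.card_eq [Fintype V] {G : FinHypergraph V} (hG : G.IsSupertree) :
    Fintype.card V = 1 + ∑ e ∈ G.edges, (e.card - 1) := by
  classical
  obtain ⟨r⟩ := hG.1.1
  obtain ⟨R⟩ := hG.nonempty_rooting r
  have hcard := Finset.card_eq_sum_card_fiberwise (s := Finset.univ.erase r) (t := G.edges)
    (f := R.parentEdge) fun v hv => R.parentEdge_mem v (Finset.ne_of_mem_erase hv)
  rw [Finset.sum_congr rfl fun e he => by
    rw [R.filter_parentEdge_eq he, Finset.card_erase_of_mem (R.top_mem e he)]] at hcard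
  rw [← Finset.card_univ, ← Finset.card_erase_add_one (Finset.mem_univ r), hcard, add_comm]

theorem IsUniform.sum_card_sub_one {G : FinHypergraph V} {k : ℕ} (hG : G.IsUniform k) :
    ∑ e ∈ G.edges, (e.card - 1) = G.edges.card * (k - 1) :=
  Finset.sum_const_nat fun e he => by rw [hG e he]

theorem IsSupertree.card_eq_of_isUniform [Fintype V] {G : FinHypergraph V} (hG : G.IsSupertree)
    {k : ℕ} (hk : G.IsUniform k) : Fintype.card V = 1 + G.edges.card * (k - 1) := by
  rw [hG.card_eq, hk.sum_card_sub_one]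

variable {F : Finset (Finset V)} {r : V}

theorem card_le_one_add_sum_of_reachable [Fintype V] (h : ∀ v, (twoSection F).Reachable v r) :
    Fintype.card V ≤ 1 + ∑ e ∈ F, (e.card - 1) := by
  classical
  have hedge : ∀ v, ∃ e, v ≠ r → e ∈ F ∧ v ∈ e ∧
      ∃ y ∈ e, (twoSection F).dist v r = (twoSection F).dist y r + 1 := fun v => by
    by_cases hv : v = r
    · exact ⟨∅, fun h => absurd hv h⟩
    · obtain ⟨e, he, hve⟩ := twoSection.exists_mem_dist_eq_succ (h v) hv
      exact ⟨e, fun _ => ⟨he, hve⟩⟩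
  choose edge hedge using hedge
  have hfiber : ∀ e ∈ F, ((Finset.univ.erase r).filter fun v => edge v = e).card ≤ e.card - 1 := by
    intro e _
    rcases e.eq_empty_or_nonempty with rfl | hne
    · refine (Finset.card_eq_zero.2 (Finset.filter_eq_empty_iff.2 fun v hv hve => ?_)).le
      exact Finset.notMem_empty v (hve ▸ (hedge v (Finset.ne_of_mem_erase hv)).2.1)
    · -- The edge leads the vertices of the fiber towards the root, so its lowest vertex is missed.
      obtain ⟨b, hb, hmin⟩ := e.exists_min_image (fun v => (twoSection F).dist v r) hne
      rw [← Finset.card_erase_of_mem hb]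
      refine Finset.card_le_card fun v hv => ?_
      obtain ⟨hvr, rfl⟩ := Finset.mem_filter.1 hv
      obtain ⟨-, hve, y, hy, hd⟩ := hedge v (Finset.ne_of_mem_erase hvr)
      refine Finset.mem_erase.2 ⟨?_, hve⟩
      rintro rfl
      have := hmin y hy
      omega
  have hcard := Finset.card_eq_sum_card_fiberwise (s := Finset.univ.erase r) (t := F) (f := edge)
    fun v hv => (hedge v (Finset.ne_of_mem_erase hv)).1
  rw [← Finset.card_univ, ← Finset.card_erase_add_one (Finset.mem_univ r), hcard, add_comm]
  exact Nat.add_le_add_left (Finset.sum_le_sum hfiber) 1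

theorem card_lt_one_add_sum_of_reachable_erase [Fintype V] [DecidableEq V]
    (h : ∀ v, (twoSection F).Reachable v r)
    {e : Finset V} (he : e ∈ F) {x y : V} (hx : x ∈ e) (hy : y ∈ e) (hxy : x ≠ y)
    (hr : (twoSection (F.erase e)).Reachable x y) : Fintype.card V < 1 + ∑ e ∈ F, (e.card - 1) := by
  -- Shrinking `e` by `x` keeps the family connected.
  set F' := insert (e.erase x) (F.erase e)
  have hsub : F.erase e ⊆ F' := Finset.subset_insert _ _
  have hyw : ∀ w ∈ e, (twoSection F').Reachable y w := fun w hw => by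
    by_cases hwx : w = x
    · exact hwx ▸ (hr.mono (twoSection.mono hsub)).symm
    · exact twoSection.reachable_of_mem (Finset.mem_insert_self _ _)
        (Finset.mem_erase.2 ⟨hxy.symm, hy⟩) (Finset.mem_erase.2 ⟨hwx, hw⟩)
  have hreach : ∀ v, (twoSection F').Reachable v r := fun v => by
    refine twoSection.reachable_of_forall_mem (fun e' he' a ha b hb => ?_) (h v)
    by_cases hee : e' = e
    · subst hee
      exact (hyw a ha).symm.trans (hyw b hb)
    · exact twoSection.reachable_of_mem (hsub (Finset.mem_erase.2 ⟨hee, he'⟩)) ha hb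
  have hle : ∑ e' ∈ F', (e'.card - 1) ≤
      ((e.erase x).card - 1) + ∑ e' ∈ F.erase e, (e'.card - 1) := by
    by_cases hin : e.erase x ∈ F.erase e
    · simp only [F', Finset.insert_eq_of_mem hin, le_add_iff_nonneg_left, zero_le]
    · exact (Finset.sum_insert hin).le
  have hcard := card_le_one_add_sum_of_reachable hreach
  have hsum := Finset.add_sum_erase F (fun e' => e'.card - 1) he
  have hone : 1 < e.card := Finset.one_lt_card.2 ⟨x, hx, y, hy, hxy⟩
  rw [Finset.card_erase_of_mem hx] at hle
  omega

theorem IsSupertree.of_card_edges_le [Finite V] {G H : FinHypergraph V} (hG : G.IsSupertree) {k : ℕ}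
    (hGk : G.IsUniform k) (hHk : H.IsUniform k) (hle : H.edges.card ≤ G.edges.card)
    (hr : ∀ e ∈ G.edges, ∀ x ∈ e, ∀ y ∈ e, (twoSection H.edges).Reachable x y) :
    H.IsSupertree := by
  classical
  have := Fintype.ofFinite V
  have hcon : ∀ a b, (twoSection H.edges).Reachable a b :=
    fun a b => twoSection.reachable_of_forall_mem hr (hG.1.reachable a b)
  have : Nonempty V := hG.1.1
  refine ⟨isConnected_of_reachable hcon, isAcyclic_of_not_reachable_erase ?_⟩
  intro e he x hx y hy hxy hre
  have hlt := card_lt_one_add_sum_of_reachable_erase (fun v => hcon v x) he hx hy hxy hre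
  rw [hHk.sum_card_sub_one, hG.card_eq_of_isUniform hGk] at hlt
  have := Nat.mul_le_mul_right (k - 1) hle
  omega

end EdgeCount

section Energy

variable {V : Type*}

/-- The Dirichlet form of a `k`-uniform hypergraph, multiplied by `k - 1`. -/
def energy (G : FinHypergraph V) (k : ℕ) (f : V → ℝ) : ℝ :=
  ∑ e ∈ G.edges, (k * ∑ v ∈ e, f v ^ 2 - (∑ v ∈ e, f v) ^ 2)

theorem energy_zero (G : FinHypergraph V) (k : ℕ) : G.energy k 0 = 0 := by
  simp [energy]

theorem energy_smul (G : FinHypergraph V) (k : ℕ) (t : ℝ) (f : V → ℝ) :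
    G.energy k (t • f) = t ^ 2 * G.energy k f := by
  rw [energy, energy, Finset.mul_sum]
  refine Finset.sum_congr rfl fun e _ => ?_
  simp only [Pi.smul_apply, smul_eq_mul, mul_pow, ← Finset.mul_sum]
  ring

theorem energy_abs_le (G : FinHypergraph V) (k : ℕ) (f : V → ℝ) :
    G.energy k (fun v => |f v|) ≤ G.energy k f := by
  refine Finset.sum_le_sum fun e _ => ?_
  simp only [sq_abs]
  gcongr 1
  exact sq_le_sq.2 ((Finset.abs_sum_le_sum_abs _ _).trans (le_abs_self _))

theorem continuous_energy (G : FinHypergraph V) (k : ℕ) : Continuous (G.energy k) := by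
  unfold energy
  fun_prop

variable [DecidableEq V]

theorem isInterior_of_mem_of_mem {G : FinHypergraph V} {v : V} {e₁ e₂ : Finset V}
    (h₁ : e₁ ∈ G.edges) (h₂ : e₂ ∈ G.edges) (hv₁ : v ∈ e₁) (hv₂ : v ∈ e₂) (hne : e₁ ≠ e₂) :
    G.IsInterior v :=
  (Finset.one_lt_card.2 ⟨e₁, Finset.mem_filter.2 ⟨h₁, hv₁⟩, e₂, Finset.mem_filter.2 ⟨h₂, hv₂⟩,
    hne⟩).ne'

theorem IsPath.isInterior {G : FinHypergraph V} {p : ℕ} {u : Fin (p + 1) → V}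
    {e : Fin p → Finset V} (h : G.IsPath p u e) (h₀ : G.IsInterior (u 0)) (i : Fin p) :
    G.IsInterior (u i.castSucc) := by
  obtain ⟨p, rfl⟩ : ∃ q, p = q + 1 := Nat.exists_eq_succ_of_ne_zero i.pos.ne'
  refine Fin.cases h₀ (fun j => ?_) i
  refine isInterior_of_mem_of_mem (h.1 j.castSucc).1 (h.1 j.succ).1 (h.1 j.castSucc).2.2
    (h.1 j.succ).2.1 fun heq => ?_
  simpa [Fin.ext_iff] using h.2.2 heq

/-- The Laplacian of a `k`-uniform hypergraph, multiplied by `k - 1`. -/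
def scaledLap (G : FinHypergraph V) (k : ℕ) (f : V → ℝ) (v : V) : ℝ :=
  ∑ e ∈ G.edges with v ∈ e, (k * f v - ∑ w ∈ e, f w)

theorem eq_zero_of_scaledLap_eq_zero {G : FinHypergraph V} {k : ℕ} {f : V → ℝ} (hf : 0 ≤ f)
    {v : V} (hv : f v = 0) (h : G.scaledLap k f v = 0) {e : Finset V} (he : e ∈ G.edges)
    (hve : v ∈ e) {w : V} (hw : w ∈ e) : f w = 0 := by
  simp only [scaledLap, hv, mul_zero, zero_sub, Finset.sum_neg_distrib, neg_eq_zero] at h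
  have hsum := (Finset.sum_eq_zero_iff_of_nonneg fun e' _ => Finset.sum_nonneg fun w _ => hf w).1 h
    e (Finset.mem_filter.2 ⟨he, hve⟩)
  exact (Finset.sum_eq_zero_iff_of_nonneg fun w _ => hf w).1 hsum w hw

theorem IsConnected.eq_zero_of_eigenfunction {G : FinHypergraph V} {k : ℕ} {c : ℝ} {f : V → ℝ}
    (hG : G.IsConnected) (hf : 0 ≤ f) (h : ∀ v, G.IsInterior v → G.scaledLap k f v = c * f v)
    {a : V} (ha : G.IsInterior a) (ha₀ : f a = 0) : f = 0 := by
  funext b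
  obtain ⟨p, u, e, hpath, rfl, rfl⟩ := hG.2 a b
  have hzero : ∀ i, f (u i) = 0 := by
    intro i
    induction i using Fin.induction with
    | zero => exact ha₀
    | succ j ih =>
      obtain ⟨he, hleft, hright⟩ := hpath.1 j
      have hlap : G.scaledLap k f (u j.castSucc) = 0 := by
        rw [h _ (hpath.isInterior ha j), ih, mul_zero]
      exact eq_zero_of_scaledLap_eq_zero hf ih hlap he hleft hright
  exact hzero _

variable [Fintype V]

theorem sum_mul_scaledLap (G : FinHypergraph V) (k : ℕ) (f g : V → ℝ) :
    ∑ v, g v * G.scaledLap k f v =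
      ∑ e ∈ G.edges, (k * ∑ v ∈ e, g v * f v - (∑ v ∈ e, g v) * ∑ v ∈ e, f v) := by
  simp only [scaledLap, Finset.sum_filter, Finset.mul_sum G.edges]
  rw [Finset.sum_comm]
  refine Finset.sum_congr rfl fun e _ => ?_
  simp only [Finset.sum_ite_mem, mul_ite, mul_zero, Finset.univ_inter]
  rw [Finset.mul_sum, Finset.sum_mul, ← Finset.sum_sub_distrib]
  exact Finset.sum_congr rfl fun v _ => by ring

theorem energy_eq_sum (G : FinHypergraph V) (k : ℕ) (f : V → ℝ) :
    G.energy k f = ∑ v, f v * G.scaledLap k f v := by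
  simp only [sum_mul_scaledLap, energy, sq]

theorem energy_add (G : FinHypergraph V) (k : ℕ) (f g : V → ℝ) :
    G.energy k (f + g) = G.energy k f + 2 * ∑ v, g v * G.scaledLap k f v + G.energy k g := by
  simp only [sum_mul_scaledLap, energy, Finset.mul_sum G.edges, ← Finset.sum_add_distrib]
  refine Finset.sum_congr rfl fun e _ => ?_
  have hsq : ∑ v ∈ e, (f + g) v ^ 2 =
      ∑ v ∈ e, f v ^ 2 + 2 * ∑ v ∈ e, g v * f v + ∑ v ∈ e, g v ^ 2 := by
    rw [Finset.mul_sum, ← Finset.sum_add_distrib, ← Finset.sum_add_distrib]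
    exact Finset.sum_congr rfl fun v _ => by simp only [Pi.add_apply]; ring
  rw [hsq]
  simp only [Pi.add_apply, Finset.sum_add_distrib]
  ring

theorem IsUniform.mul_adjMatrix_mulVec {G : FinHypergraph V} {k : ℕ} (hG : G.IsUniform k)
    (hk : 2 ≤ k) (f : V → ℝ) (v : V) :
    ((k : ℝ) - 1) * G.adjMatrix.mulVec f v = ∑ e ∈ G.edges with v ∈ e, (∑ w ∈ e, f w - f v) := by
  have hk' : (k : ℝ) - 1 ≠ 0 := sub_ne_zero.2 (by exact_mod_cast (by omega : k ≠ 1))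
  have hentry : ∀ w, ((k : ℝ) - 1) * (G.adjMatrix v w * f w) =
      ∑ e ∈ G.edges with v ∈ e, if w ∈ e.erase v then f w else 0 := by
    intro w
    by_cases hvw : v = w
    · simp [adjMatrix, hvw]
    · have hconst : ∑ e ∈ G.edges with v ∈ e ∧ w ∈ e, 1 / ((e.card : ℝ) - 1) =
          ∑ e ∈ G.edges with v ∈ e ∧ w ∈ e, 1 / ((k : ℝ) - 1) :=
        Finset.sum_congr rfl fun e he => by rw [hG e (Finset.mem_filter.1 he).1]
      simp only [adjMatrix, Matrix.of_apply, if_neg hvw, hconst, Finset.mem_erase,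
        ne_eq, Ne.symm hvw, not_false_eq_true, true_and, ← Finset.sum_filter,
        Finset.filter_filter, Finset.sum_const, nsmul_eq_mul]
      field_simp
  rw [Matrix.mulVec, dotProduct, Finset.mul_sum, Finset.sum_congr rfl fun w _ => hentry w,
    Finset.sum_comm]
  refine Finset.sum_congr rfl fun e he => ?_
  rw [Finset.sum_ite_mem, Finset.univ_inter, Finset.sum_erase_eq_sub (Finset.mem_filter.1 he).2]

theorem IsUniform.scaledLap_eq {G : FinHypergraph V} {k : ℕ} (hG : G.IsUniform k) (hk : 2 ≤ k)
    (f : V → ℝ) (v : V) : G.scaledLap k f v = ((k : ℝ) - 1) * G.lapMatrix.mulVec f v := by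
  rw [lapMatrix, Matrix.sub_mulVec, Pi.sub_apply, mul_sub, hG.mul_adjMatrix_mulVec hk,
    Matrix.mulVec_diagonal, scaledLap, degree]
  simp only [Finset.sum_sub_distrib, Finset.sum_const, nsmul_eq_mul]
  ring

end Energy

section GroundState

theorem eq_zero_of_forall_quadratic_nonneg {b D : ℝ} (h : ∀ t : ℝ, 0 ≤ D * t ^ 2 + 2 * b * t) :
    b = 0 := by
  have hdiscrim : discrim D (2 * b) 0 ≤ 0 := discrim_le_zero fun t => by
    have := h t
    rw [sq] at this
    linarith
  rw [discrim] at hdiscrim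
  nlinarith [sq_nonneg b]

variable {V : Type*} [Fintype V]

theorem sum_sq_pos {f : V → ℝ} (hf : f ≠ 0) : 0 < ∑ v, f v ^ 2 := by
  obtain ⟨v, hv⟩ := Function.ne_iff.1 hf
  exact Finset.sum_pos' (fun v _ => sq_nonneg _) ⟨v, Finset.mem_univ v, sq_pos_of_ne_zero hv⟩

variable [DecidableEq V]

/-- `f` is a positive first Dirichlet eigenfunction, and `c` is the first Dirichlet eigenvalue,
for the Laplacian multiplied by `k - 1`. -/
structure IsGroundState (G : FinHypergraph V) (k : ℕ) (c : ℝ) (f : V → ℝ) : Prop where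
  pos : ∀ v, G.IsInterior v → 0 < f v
  zero : ∀ v, G.IsBoundary v → f v = 0
  eigen : ∀ v, G.IsInterior v → G.scaledLap k f v = c * f v
  le_energy : ∀ g : V → ℝ, (∀ v, G.IsBoundary v → g v = 0) → c * ∑ v, g v ^ 2 ≤ G.energy k g

variable {G : FinHypergraph V} {k : ℕ}

theorem energy_eq_of_eigenfunction {c : ℝ} {f : V → ℝ} (hf : ∀ v, G.IsBoundary v → f v = 0)
    (h : ∀ v, G.IsInterior v → G.scaledLap k f v = c * f v) :
    G.energy k f = c * ∑ v, f v ^ 2 := by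
  rw [energy_eq_sum, Finset.mul_sum]
  refine Finset.sum_congr rfl fun v _ => ?_
  by_cases hv : G.IsBoundary v
  · simp [hf v hv]
  · rw [h v hv]
    ring

theorem sum_add_smul_single_sq (f : V → ℝ) (v : V) (t : ℝ) :
    ∑ w, (f + t • (Pi.single v 1 : V → ℝ)) w ^ 2 = ∑ w, f w ^ 2 + 2 * t * f v + t ^ 2 := by
  have hterm : ∀ w, (f + t • (Pi.single v 1 : V → ℝ)) w ^ 2 =
      f w ^ 2 + if w = v then 2 * t * f v + t ^ 2 else 0 := fun w => by
    by_cases hw : w = v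
    · subst hw
      simp only [Pi.add_apply, Pi.smul_apply, Pi.single_eq_same, smul_eq_mul, if_true]
      ring
    · simp [hw]
  simp only [hterm, Finset.sum_add_distrib, Finset.sum_ite_eq', Finset.mem_univ, if_true, add_assoc]

theorem scaledLap_eq_of_energy_le {c : ℝ} {f : V → ℝ}
    (hc : ∀ g : V → ℝ, (∀ v, G.IsBoundary v → g v = 0) → c * ∑ v, g v ^ 2 ≤ G.energy k g)
    (hf : ∀ v, G.IsBoundary v → f v = 0) (hle : G.energy k f ≤ c * ∑ v, f v ^ 2) {v : V}
    (hv : G.IsInterior v) : G.scaledLap k f v = c * f v := by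
  refine sub_eq_zero.1 (eq_zero_of_forall_quadratic_nonneg
    (D := G.energy k (Pi.single v 1) - c) fun t => ?_)
  have hvar := hc (f + t • Pi.single v 1) fun w hw => by
    have hwv : w ≠ v := by rintro rfl; exact hv hw
    simp [hf w hw, hwv]
  have hcross : ∑ w, (t • (Pi.single v 1 : V → ℝ)) w * G.scaledLap k f w =
      t * G.scaledLap k f v := by
    rw [Finset.sum_eq_single v (fun w _ hw => by simp [hw]) (by simp)]
    simp
  rw [energy_add, energy_smul, hcross, sum_add_smul_single_sq] at hvar
  linarith

theorem exists_energy_isMinOn (k : ℕ) (hint : ∃ v, G.IsInterior v) :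
    ∃ f ∈ {g : V → ℝ | ∑ v, g v ^ 2 = 1 ∧ ∀ v, G.IsBoundary v → g v = 0},
      IsMinOn (G.energy k) {g : V → ℝ | ∑ v, g v ^ 2 = 1 ∧ ∀ v, G.IsBoundary v → g v = 0} f := by
  obtain ⟨v₀, hv₀⟩ := hint
  refine (Metric.isCompact_of_isClosed_isBounded ?_ ?_).exists_isMinOn ?_
    (continuous_energy G k).continuousOn
  · simp only [Set.ofPred_and, Set.ofPred_forall]
    exact (isClosed_eq (by fun_prop) continuous_const).inter <| isClosed_iInter fun v =>
      isClosed_iInter fun _ => isClosed_eq (continuous_apply v) continuous_const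
  · refine (Metric.isBounded_closedBall (x := (0 : V → ℝ)) (r := 1)).subset fun g hg => ?_
    rw [mem_closedBall_zero_iff, pi_norm_le_iff_of_nonneg zero_le_one]
    intro v
    rw [Real.norm_eq_abs, ← sq_le_one_iff_abs_le_one, ← hg.1]
    exact Finset.single_le_sum (f := fun w => g w ^ 2) (fun w _ => sq_nonneg _) (Finset.mem_univ v)
  · refine ⟨Pi.single v₀ 1, ?_, fun v hv => ?_⟩
    · simpa using sum_add_smul_single_sq 0 v₀ 1
    · have hvv₀ : v ≠ v₀ := by rintro rfl; exact hv₀ hv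
      simp [hvv₀]

theorem exists_energy_eq_forall_le (k : ℕ) (hint : ∃ v, G.IsInterior v) :
    ∃ (c : ℝ) (f : V → ℝ), f ≠ 0 ∧ (∀ v, G.IsBoundary v → f v = 0) ∧
      G.energy k f = c * ∑ v, f v ^ 2 ∧
      ∀ g : V → ℝ, (∀ v, G.IsBoundary v → g v = 0) → c * ∑ v, g v ^ 2 ≤ G.energy k g := by
  obtain ⟨f, ⟨hf₁, hf⟩, hmin⟩ := exists_energy_isMinOn k hint
  refine ⟨G.energy k f, f, ?_, hf, by rw [hf₁, mul_one], fun g hg => ?_⟩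
  · rintro rfl
    simp at hf₁
  by_cases hg₀ : g = 0
  · simp [hg₀, energy_zero]
  set s := √(∑ v, g v ^ 2)
  have hs : 0 < s := Real.sqrt_pos.2 (sum_sq_pos hg₀)
  have hs₂ : s ^ 2 = ∑ v, g v ^ 2 := Real.sq_sqrt (sum_sq_pos hg₀).le
  have hle : G.energy k f ≤ G.energy k (s⁻¹ • g) := by
    refine hmin ⟨?_, fun v hv => by simp [hg v hv]⟩
    simp only [Pi.smul_apply, smul_eq_mul, mul_pow, ← Finset.mul_sum, ← hs₂]
    field_simp
  rwa [energy_smul, inv_pow, ← div_eq_inv_mul, le_div_iff₀ (by positivity), hs₂] at hle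

theorem IsUniform.firstDirichletEigenvalue_eq (hG : G.IsUniform k) (hk : 2 ≤ k) {c : ℝ} {f : V → ℝ}
    (hf₀ : f ≠ 0) (hf : ∀ v, G.IsBoundary v → f v = 0)
    (heig : ∀ v, G.IsInterior v → G.scaledLap k f v = c * f v)
    (hc : ∀ g : V → ℝ, (∀ v, G.IsBoundary v → g v = 0) → c * ∑ v, g v ^ 2 ≤ G.energy k g) :
    ((k : ℝ) - 1) * G.firstDirichletEigenvalue = c := by
  have hk' : (0 : ℝ) < (k : ℝ) - 1 := sub_pos.2 (by exact_mod_cast hk)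
  have hleast : IsLeast {c : ℝ | G.IsDirichletEigenvalue c} (c / ((k : ℝ) - 1)) := by
    refine ⟨⟨f, hf₀, fun v hv => ?_, hf⟩, ?_⟩
    · have := heig v hv
      rw [hG.scaledLap_eq hk] at this
      field_simp
      linarith
    · rintro c' ⟨g, hg₀, hg_eigen, hg⟩
      have henergy : G.energy k g = ((k : ℝ) - 1) * c' * ∑ v, g v ^ 2 :=
        energy_eq_of_eigenfunction hg fun v hv => by
          rw [hG.scaledLap_eq hk, hg_eigen v hv, mul_assoc]
      rw [div_le_iff₀' hk']
      exact le_of_mul_le_mul_right ((hc g hg).trans_eq henergy) (sum_sq_pos hg₀)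
  rw [firstDirichletEigenvalue, hleast.csInf_eq, mul_div_cancel₀ _ hk'.ne']

theorem IsConnected.exists_isGroundState (hcon : G.IsConnected) (hG : G.IsUniform k) (hk : 2 ≤ k)
    (hint : ∃ v, G.IsInterior v) :
    ∃ f, G.IsGroundState k (((k : ℝ) - 1) * G.firstDirichletEigenvalue) f := by
  obtain ⟨c, g, hg₀, hg, henergy, hc⟩ := exists_energy_eq_forall_le k hint
  set f : V → ℝ := fun v => |g v|
  have hf : ∀ v, G.IsBoundary v → f v = 0 := fun v hv => abs_eq_zero.2 (hg v hv)
  have hf₀ : f ≠ 0 := fun h => hg₀ (funext fun v => abs_eq_zero.1 (congrFun h v))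
  have hle : G.energy k f ≤ c * ∑ v, f v ^ 2 := by
    simpa only [f, sq_abs, ← henergy] using energy_abs_le G k g
  have heig : ∀ v, G.IsInterior v → G.scaledLap k f v = c * f v :=
    fun v hv => scaledLap_eq_of_energy_le hc hf hle hv
  rw [hG.firstDirichletEigenvalue_eq hk hf₀ hf heig hc]
  refine ⟨f, fun v hv => (abs_nonneg _).lt_of_ne' fun hv₀ => hf₀ ?_, hf, heig, hc⟩
  exact hcon.eq_zero_of_eigenfunction (fun v => abs_nonneg _) heig hv hv₀

end GroundState

section Isomorphism

theorem Isomorphic.symm {V W : Type*} {G : FinHypergraph V} {H : FinHypergraph W}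
    (h : G.Isomorphic H) : H.Isomorphic G := by
  obtain ⟨σ, hσ⟩ := h
  refine ⟨σ.symm, fun e => ?_⟩
  rw [← hσ, Finset.map_map]
  simp

theorem edges_eq_map {V W : Type*} {G : FinHypergraph V} {H : FinHypergraph W} {σ : V ≃ W}
    (hσ : ∀ e : Finset V, e.map σ.toEmbedding ∈ H.edges ↔ e ∈ G.edges) :
    H.edges = G.edges.map (Finset.mapEmbedding σ.toEmbedding).toEmbedding := by
  ext e
  simp only [Finset.mem_map, RelEmbedding.coe_toEmbedding, Finset.mapEmbedding_apply]
  constructor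
  · intro he
    have hmap : (e.map σ.symm.toEmbedding).map σ.toEmbedding = e := by simp [Finset.map_map]
    exact ⟨e.map σ.symm.toEmbedding, (hσ _).1 (hmap.symm ▸ he), hmap⟩
  · rintro ⟨e', he', rfl⟩
    exact (hσ e').2 he'

variable {V W : Type*} [DecidableEq V] [DecidableEq W] {G : FinHypergraph V}
  {H : FinHypergraph W} {σ : V ≃ W}

theorem degree_map (hσ : ∀ e : Finset V, e.map σ.toEmbedding ∈ H.edges ↔ e ∈ G.edges) (v : V) :
    H.degree (σ v) = G.degree v := by
  rw [degree, degree, edges_eq_map hσ, Finset.filter_map, Finset.card_map]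
  congr! 3 with e
  simp

theorem adjMatrix_map (hσ : ∀ e : Finset V, e.map σ.toEmbedding ∈ H.edges ↔ e ∈ G.edges)
    (v w : V) : H.adjMatrix (σ v) (σ w) = G.adjMatrix v w := by
  simp only [adjMatrix, Matrix.of_apply, σ.injective.eq_iff]
  rw [edges_eq_map hσ, Finset.filter_map, Finset.sum_map]
  congr 1
  exact Finset.sum_congr (Finset.filter_congr fun e _ => by simp) fun e _ => by simp

variable [Fintype V] [Fintype W]

theorem IsDirichletEigenvalue.of_isomorphic (h : G.Isomorphic H) {c : ℝ}
    (hc : H.IsDirichletEigenvalue c) : G.IsDirichletEigenvalue c := by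
  obtain ⟨σ, hσ⟩ := h
  obtain ⟨f, hf₀, heig, hf⟩ := hc
  have hboundary : ∀ v, H.IsBoundary (σ v) ↔ G.IsBoundary v := fun v => by
    rw [IsBoundary, IsBoundary, degree_map hσ]
  refine ⟨f ∘ σ, fun h => hf₀ ?_, fun v hv => ?_, fun v hv => hf _ ((hboundary v).2 hv)⟩
  · funext w
    simpa using congrFun h (σ.symm w)
  · rw [Function.comp_apply, ← heig (σ v) (mt (hboundary v).1 hv), lapMatrix, lapMatrix,
      Matrix.sub_mulVec, Matrix.sub_mulVec, Pi.sub_apply, Pi.sub_apply, Matrix.mulVec_diagonal,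
      Matrix.mulVec_diagonal, degree_map hσ, Matrix.mulVec, Matrix.mulVec, dotProduct, dotProduct,
      ← Equiv.sum_comp σ]
    simp only [adjMatrix_map hσ, Function.comp_apply]

theorem Isomorphic.firstDirichletEigenvalue_eq (h : G.Isomorphic H) :
    G.firstDirichletEigenvalue = H.firstDirichletEigenvalue :=
  congrArg sInf (Set.ext fun _ => ⟨fun hc => hc.of_isomorphic h.symm, fun hc => hc.of_isomorphic h⟩)

end Isomorphism

section Switch

variable {V : Type*} [DecidableEq V]

/-- The hypergraph in which the edges `e₁`, `e₂` of `G` have exchanged their vertices `z₁`, `z₂`. -/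
def switch (G : FinHypergraph V) (e₁ : Finset V) (z₁ : V) (e₂ : Finset V) (z₂ : V) :
    FinHypergraph V where
  edges := insert (insert z₂ (e₁.erase z₁))
    (insert (insert z₁ (e₂.erase z₂)) ((G.edges.erase e₁).erase e₂))
  nonempty_of_mem e he := by
    rw [Finset.mem_insert, Finset.mem_insert] at he
    rcases he with rfl | rfl | he
    · exact Finset.insert_nonempty _ _
    · exact Finset.insert_nonempty _ _
    · exact G.nonempty_of_mem e (Finset.mem_of_mem_erase (Finset.mem_of_mem_erase he))

/-- The vertices `z₁` and `z₂` can be exchanged between the edges `e₁` and `e₂` without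
disconnecting `G`: the new edges are joined by the other edges. -/
structure Switchable (G : FinHypergraph V) (e₁ : Finset V) (z₁ : V) (e₂ : Finset V) (z₂ : V) :
    Prop where
  mem₁ : e₁ ∈ G.edges
  mem₂ : e₂ ∈ G.edges
  mem_left : z₁ ∈ e₁
  notMem_left : z₁ ∉ e₂
  mem_right : z₂ ∈ e₂
  notMem_right : z₂ ∉ e₁
  exists_reachable : ∃ p₁ ∈ insert z₂ (e₁.erase z₁), ∃ p₂ ∈ insert z₁ (e₂.erase z₂),
    (twoSection ((G.edges.erase e₁).erase e₂)).Reachable p₁ p₂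

namespace Switchable

variable {G : FinHypergraph V} {e₁ e₂ : Finset V} {z₁ z₂ : V} {k : ℕ}

theorem ne (S : G.Switchable e₁ z₁ e₂ z₂) : z₁ ≠ z₂ :=
  fun h => S.notMem_left (h ▸ S.mem_right)

theorem mem₂_erase (S : G.Switchable e₁ z₁ e₂ z₂) : e₂ ∈ G.edges.erase e₁ :=
  Finset.mem_erase.2 ⟨fun h => S.notMem_left (h ▸ S.mem_left), S.mem₂⟩

theorem sum_edges {M : Type*} [AddCommMonoid M] (S : G.Switchable e₁ z₁ e₂ z₂)
    (φ : Finset V → M) :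
    ∑ e ∈ G.edges, φ e = φ e₁ + (φ e₂ + ∑ e ∈ (G.edges.erase e₁).erase e₂, φ e) := by
  rw [Finset.add_sum_erase _ _ S.mem₂_erase, Finset.add_sum_erase _ _ S.mem₁]

theorem notMem_erase_left (S : G.Switchable e₁ z₁ e₂ z₂) : z₂ ∉ e₁.erase z₁ :=
  fun h => S.notMem_right (Finset.mem_of_mem_erase h)

theorem notMem_erase_right (S : G.Switchable e₁ z₁ e₂ z₂) : z₁ ∉ e₂.erase z₂ :=
  fun h => S.notMem_left (Finset.mem_of_mem_erase h)

theorem isUniform_switch (S : G.Switchable e₁ z₁ e₂ z₂) (hG : G.IsUniform k) :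
    (G.switch e₁ z₁ e₂ z₂).IsUniform k := by
  intro e he
  rw [switch, Finset.mem_insert, Finset.mem_insert] at he
  rcases he with rfl | rfl | he
  · rw [Finset.card_insert_of_notMem S.notMem_erase_left, Finset.card_erase_add_one S.mem_left,
      hG e₁ S.mem₁]
  · rw [Finset.card_insert_of_notMem S.notMem_erase_right, Finset.card_erase_add_one S.mem_right,
      hG e₂ S.mem₂]
  · exact hG e (Finset.mem_of_mem_erase (Finset.mem_of_mem_erase he))

theorem card_erase_erase_add_two (S : G.Switchable e₁ z₁ e₂ z₂) :
    ((G.edges.erase e₁).erase e₂).card + 2 = G.edges.card := by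
  rw [← Finset.card_erase_add_one S.mem₁, ← Finset.card_erase_add_one S.mem₂_erase]

theorem isSupertree_switch [Finite V] (S : G.Switchable e₁ z₁ e₂ z₂) (hG : G.IsSupertree)
    (hu : G.IsUniform k) : (G.switch e₁ z₁ e₂ z₂).IsSupertree := by
  set H := G.switch e₁ z₁ e₂ z₂
  have hmem₁ : insert z₂ (e₁.erase z₁) ∈ H.edges := Finset.mem_insert_self _ _
  have hmem₂ : insert z₁ (e₂.erase z₂) ∈ H.edges :=
    Finset.mem_insert_of_mem (Finset.mem_insert_self _ _)
  have hrest : (G.edges.erase e₁).erase e₂ ⊆ H.edges :=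
    (Finset.subset_insert _ _).trans (Finset.subset_insert _ _)
  obtain ⟨p₁, hp₁, p₂, hp₂, hp⟩ := S.exists_reachable
  have hleft : ∀ w ∈ insert z₂ (e₁.erase z₁), (twoSection H.edges).Reachable w p₁ :=
    fun w hw => twoSection.reachable_of_mem hmem₁ hw hp₁
  have hright : ∀ w ∈ insert z₁ (e₂.erase z₂), (twoSection H.edges).Reachable w p₁ :=
    fun w hw => (twoSection.reachable_of_mem hmem₂ hw hp₂).trans
      (hp.mono (twoSection.mono hrest)).symm
  have hreach : ∀ w, w ∈ e₁ ∨ w ∈ e₂ → (twoSection H.edges).Reachable w p₁ := by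
    intro w hw
    by_cases hw₁ : w ∈ insert z₂ (e₁.erase z₁)
    · exact hleft w hw₁
    · refine hright w ?_
      simp only [Finset.mem_insert, Finset.mem_erase] at hw₁ ⊢
      tauto
  have hcard : H.edges.card ≤ G.edges.card := by
    rw [← S.card_erase_erase_add_two]
    exact (Finset.card_insert_le _ _).trans (Nat.succ_le_succ (Finset.card_insert_le _ _))
  refine hG.of_card_edges_le hu (S.isUniform_switch hu) hcard fun e he x hx y hy => ?_
  by_cases he₁ : e = e₁
  · subst he₁
    exact (hreach x (.inl hx)).trans (hreach y (.inl hy)).symm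
  by_cases he₂ : e = e₂
  · subst he₂
    exact (hreach x (.inr hx)).trans (hreach y (.inr hy)).symm
  exact twoSection.reachable_of_mem
    (hrest (Finset.mem_erase.2 ⟨he₂, Finset.mem_erase.2 ⟨he₁, he⟩⟩)) hx hy

theorem sum_edges_switch [Finite V] {M : Type*} [AddCommMonoid M] (S : G.Switchable e₁ z₁ e₂ z₂)
    (hG : G.IsSupertree) (hu : G.IsUniform k) (hk : 2 ≤ k) (φ : Finset V → M) :
    ∑ e ∈ (G.switch e₁ z₁ e₂ z₂).edges, φ e = φ (insert z₂ (e₁.erase z₁)) +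
      (φ (insert z₁ (e₂.erase z₂)) + ∑ e ∈ (G.edges.erase e₁).erase e₂, φ e) := by
  have := Fintype.ofFinite V
  set e₁' := insert z₂ (e₁.erase z₁)
  set e₂' := insert z₁ (e₂.erase z₂)
  have hcard : (insert e₁' (insert e₂' ((G.edges.erase e₁).erase e₂))).card =
      ((G.edges.erase e₁).erase e₂).card + 2 := by
    rw [S.card_erase_erase_add_two]
    have hcard₁ := (S.isSupertree_switch hG hu).card_eq_of_isUniform (S.isUniform_switch hu)
    rw [hG.card_eq_of_isUniform hu] at hcard₁
    exact (Nat.eq_of_mul_eq_mul_right (by omega) (Nat.add_left_cancel hcard₁)).symm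
  have hcard₂ := Finset.card_insert_le e₂' ((G.edges.erase e₁).erase e₂)
  have hnew₁ : e₁' ∉ insert e₂' ((G.edges.erase e₁).erase e₂) := fun h => by
    rw [Finset.insert_eq_of_mem h] at hcard
    omega
  have hnew₂ : e₂' ∉ (G.edges.erase e₁).erase e₂ := fun h => by
    rw [Finset.card_insert_of_notMem hnew₁, Finset.insert_eq_of_mem h] at hcard
    omega
  change ∑ e ∈ insert e₁' (insert e₂' ((G.edges.erase e₁).erase e₂)), φ e = _
  rw [Finset.sum_insert hnew₁, Finset.sum_insert hnew₂]

theorem sum_insert_erase_left (S : G.Switchable e₁ z₁ e₂ z₂) (g : V → ℝ) :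
    ∑ v ∈ insert z₂ (e₁.erase z₁), g v = ∑ v ∈ e₁, g v - g z₁ + g z₂ := by
  rw [Finset.sum_insert S.notMem_erase_left, Finset.sum_erase_eq_sub S.mem_left, add_comm]

theorem sum_insert_erase_right (S : G.Switchable e₁ z₁ e₂ z₂) (g : V → ℝ) :
    ∑ v ∈ insert z₁ (e₂.erase z₂), g v = ∑ v ∈ e₂, g v - g z₂ + g z₁ := by
  rw [Finset.sum_insert S.notMem_erase_right, Finset.sum_erase_eq_sub S.mem_right, add_comm]

variable [Finite V]

theorem degree_switch (S : G.Switchable e₁ z₁ e₂ z₂) (hG : G.IsSupertree) (hu : G.IsUniform k)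
    (hk : 2 ≤ k) (v : V) : (G.switch e₁ z₁ e₂ z₂).degree v = G.degree v := by
  rw [degree, degree, Finset.card_filter, Finset.card_filter, S.sum_edges_switch hG hu hk,
    S.sum_edges, ← add_assoc, ← add_assoc]
  congr 1
  by_cases hv₁ : v = z₁
  · simp [hv₁, S.ne, S.mem_left, S.notMem_left]
  by_cases hv₂ : v = z₂
  · simp [hv₂, S.ne.symm, S.mem_right, S.notMem_right]
  · simp [hv₁, hv₂]

theorem energy_switch (S : G.Switchable e₁ z₁ e₂ z₂) (hG : G.IsSupertree) (hu : G.IsUniform k)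
    (hk : 2 ≤ k) (f : V → ℝ) :
    (G.switch e₁ z₁ e₂ z₂).energy k f = G.energy k f +
      2 * ((f z₁ - f z₂) * (∑ v ∈ e₁.erase z₁, f v - ∑ v ∈ e₂.erase z₂, f v)) := by
  rw [energy, energy, S.sum_edges_switch hG hu hk, S.sum_edges, S.sum_insert_erase_left f,
    S.sum_insert_erase_right f, S.sum_insert_erase_left, S.sum_insert_erase_right,
    Finset.sum_erase_eq_sub S.mem_left, Finset.sum_erase_eq_sub S.mem_right]
  ring

theorem scaledLap_switch_left (S : G.Switchable e₁ z₁ e₂ z₂) (hG : G.IsSupertree)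
    (hu : G.IsUniform k) (hk : 2 ≤ k) (f : V → ℝ) :
    (G.switch e₁ z₁ e₂ z₂).scaledLap k f z₁ = G.scaledLap k f z₁ +
      (∑ v ∈ e₁.erase z₁, f v - ∑ v ∈ e₂.erase z₂, f v) := by
  rw [scaledLap, scaledLap, Finset.sum_filter, Finset.sum_filter, S.sum_edges_switch hG hu hk,
    S.sum_edges, if_neg (by simp [S.ne]), if_pos (Finset.mem_insert_self _ _), if_pos S.mem_left,
    if_neg S.notMem_left, S.sum_insert_erase_right, Finset.sum_erase_eq_sub S.mem_left,
    Finset.sum_erase_eq_sub S.mem_right]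
  ring

theorem scaledLap_switch_of_mem (S : G.Switchable e₁ z₁ e₂ z₂) (hG : G.IsSupertree)
    (hu : G.IsUniform k) (hk : 2 ≤ k) (f : V → ℝ) {w : V} (hw : w ∈ e₁) (hne : w ≠ z₁)
    (hw₂ : w ∉ e₂) :
    (G.switch e₁ z₁ e₂ z₂).scaledLap k f w = G.scaledLap k f w + (f z₁ - f z₂) := by
  rw [scaledLap, scaledLap, Finset.sum_filter, Finset.sum_filter, S.sum_edges_switch hG hu hk,
    S.sum_edges, if_pos (by simp [hw, hne]), if_neg (by simp [hne, hw₂]), if_pos hw, if_neg hw₂,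
    S.sum_insert_erase_left]
  ring

end Switchable

end Switch

section Gate

variable {V : Type*} [DecidableEq V]

/-- The edges `e₁` and `e₂` are joined by a path that leaves them at `x₁` and `x₂`. -/
structure Gate (G : FinHypergraph V) (e₁ : Finset V) (x₁ : V) (e₂ : Finset V) (x₂ : V) :
    Prop where
  mem₁ : e₁ ∈ G.edges
  mem₂ : e₂ ∈ G.edges
  ne : e₁ ≠ e₂
  mem_left : x₁ ∈ e₁
  mem_right : x₂ ∈ e₂
  reachable : (twoSection ((G.edges.erase e₁).erase e₂)).Reachable x₁ x₂

namespace Gate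

variable {G : FinHypergraph V} {e₁ e₂ : Finset V} {x₁ x₂ y₁ y₂ : V}

theorem symm (g : G.Gate e₁ x₁ e₂ x₂) : G.Gate e₂ x₂ e₁ x₁ :=
  ⟨g.mem₂, g.mem₁, g.ne.symm, g.mem_right, g.mem_left,
    (Finset.erase_right_comm (s := G.edges) ▸ g.reachable).symm⟩

theorem notMem_of_ne (g : G.Gate e₁ x₁ e₂ x₂) (hG : G.IsAcyclic) (hy : y₁ ∈ e₁) (hne : y₁ ≠ x₁) :
    y₁ ∉ e₂ :=
  fun h => hne (hG.eq_of_mem_of_reachable g.mem₁ g.mem₂ g.ne g.mem_left g.mem_right g.reachable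
    hy h)

theorem notMem (g : G.Gate e₁ x₁ e₂ x₂) (hG : G.IsAcyclic) (hne : x₁ ≠ x₂) : x₁ ∉ e₂ :=
  fun h => g.symm.notMem_of_ne hG h hne g.mem_left

theorem switchable (g : G.Gate e₁ x₁ e₂ x₂) (hG : G.IsAcyclic) (hne : x₁ ≠ x₂) :
    G.Switchable e₁ x₁ e₂ x₂ :=
  ⟨g.mem₁, g.mem₂, g.mem_left, g.notMem hG hne, g.mem_right, g.symm.notMem hG hne.symm,
    x₂, Finset.mem_insert_self _ _, x₁, Finset.mem_insert_self _ _, g.reachable.symm⟩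

theorem switchable_of_ne (g : G.Gate e₁ x₁ e₂ x₂) (hG : G.IsAcyclic) (hy₁ : y₁ ∈ e₁)
    (hne₁ : y₁ ≠ x₁) (hy₂ : y₂ ∈ e₂) (hne₂ : y₂ ≠ x₂) : G.Switchable e₁ y₁ e₂ y₂ :=
  ⟨g.mem₁, g.mem₂, hy₁, g.notMem_of_ne hG hy₁ hne₁, hy₂, g.symm.notMem_of_ne hG hy₂ hne₂,
    x₁, Finset.mem_insert_of_mem (Finset.mem_erase.2 ⟨hne₁.symm, g.mem_left⟩),
    x₂, Finset.mem_insert_of_mem (Finset.mem_erase.2 ⟨hne₂.symm, g.mem_right⟩), g.reachable⟩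

end Gate

end Gate

section Boundary

variable {V : Type*} {G : FinHypergraph V} {k : ℕ}

theorem sum_sum_sub_sq (s : Finset V) (f : V → ℝ) :
    ∑ v ∈ s, ∑ w ∈ s, (f v - f w) ^ 2 =
      2 * (s.card * ∑ v ∈ s, f v ^ 2 - (∑ v ∈ s, f v) ^ 2) := by
  simp only [sub_sq, Finset.sum_add_distrib, Finset.sum_sub_distrib, Finset.sum_const,
    nsmul_eq_mul, ← Finset.mul_sum, ← Finset.sum_mul]
  ring

theorem IsUniform.two_mul_energy (hG : G.IsUniform k) (f : V → ℝ) :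
    2 * G.energy k f = ∑ e ∈ G.edges, ∑ v ∈ e, ∑ w ∈ e, (f v - f w) ^ 2 := by
  rw [energy, Finset.mul_sum]
  exact Finset.sum_congr rfl fun e he => by rw [sum_sum_sub_sq, hG e he]

theorem IsConnected.eq_of_energy_nonpos (hcon : G.IsConnected) (hG : G.IsUniform k) {f : V → ℝ}
    (hf : G.energy k f ≤ 0) (v w : V) : f v = f w := by
  have hnonneg : ∀ e ∈ G.edges, 0 ≤ ∑ v ∈ e, ∑ w ∈ e, (f v - f w) ^ 2 := fun e _ => by positivity
  have hedge : ∀ e ∈ G.edges, ∑ v ∈ e, ∑ w ∈ e, (f v - f w) ^ 2 = 0 :=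
    (Finset.sum_eq_zero_iff_of_nonneg hnonneg).1 <| le_antisymm
      (by rw [← hG.two_mul_energy]; linarith) (Finset.sum_nonneg hnonneg)
  obtain ⟨p⟩ := hcon.reachable v w
  induction p with
  | nil => rfl
  | cons hadj _ ih =>
    obtain ⟨-, e, he, hx, hy⟩ := hadj
    have hsum := (Finset.sum_eq_zero_iff_of_nonneg fun _ _ => by positivity).1 (hedge e he) _ hx
    have hsq := (Finset.sum_eq_zero_iff_of_nonneg fun _ _ => sq_nonneg _).1 hsum _ hy
    exact (sub_eq_zero.1 (pow_eq_zero_iff two_ne_zero |>.1 hsq)).trans ih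

variable [DecidableEq V]

theorem exists_edge_ne {v : V} (hv : 2 ≤ G.degree v) (e : Finset V) :
    ∃ e' ∈ G.edges, v ∈ e' ∧ e' ≠ e := by
  obtain ⟨e', he', hne⟩ := Finset.exists_mem_ne (s := G.edges.filter fun e => v ∈ e) hv e
  rw [Finset.mem_filter] at he'
  exact ⟨e', he'.1, he'.2, hne⟩

theorem IsSupertree.exists_isBoundary [Finite V] [Nontrivial V] (hG : G.IsSupertree)
    (hu : G.IsUniform k) (hk : 2 ≤ k) : ∃ v, G.IsBoundary v := by
  obtain ⟨r⟩ : Nonempty V := inferInstance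
  obtain ⟨R⟩ := hG.nonempty_rooting r
  obtain ⟨v, hv⟩ := Finite.exists_max fun v => G.dist v r
  have hvr : v ≠ r := by
    rintro rfl
    obtain ⟨w, hw⟩ := exists_ne v
    exact hw ((R.dist_eq_zero_iff w).1
      (Nat.le_zero.1 ((R.dist_eq_zero_iff v).2 rfl ▸ hv w)))
  refine ⟨v, Finset.card_eq_one.2 ⟨R.parentEdge v, ?_⟩⟩
  ext e
  rw [Finset.mem_filter, Finset.mem_singleton]
  refine ⟨fun ⟨he, hve⟩ => ?_, fun he => he ▸ ⟨R.parentEdge_mem v hvr, R.mem_parentEdge v hvr⟩⟩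
  by_contra hne
  obtain rfl := R.eq_top_of_ne_parentEdge he hve hne
  obtain ⟨y, hy, hyv⟩ := Finset.exists_mem_ne (s := e) (by rw [hu e he]; omega) (R.top e)
  have hfar := hv y
  have hsucc := R.dist_eq_succ _ he y hy hyv
  omega

end Boundary

section Extremal

variable {V : Type*} [DecidableEq V]

/-- `H` is a `k`-uniform supertree with the same boundary as `G` whose interior vertices have
degree at least `d`: a member of the class, with which `G` competes for the first eigenvalue. -/
structure IsCompetitor (H G : FinHypergraph V) (k d : ℕ) : Prop where
  uniform : H.IsUniform k
  supertree : H.IsSupertree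
  isBoundary_iff : ∀ v, H.IsBoundary v ↔ G.IsBoundary v
  le_degree : ∀ v, G.IsInterior v → d ≤ H.degree v

variable [Fintype V]

/-- `f` is the ground state of the supertree `G`, with eigenvalue `c`, and `c` is a lower bound
for the Dirichlet forms of all the competitors of `G`. -/
structure IsExtremal (G : FinHypergraph V) (k d : ℕ) (c : ℝ) (f : V → ℝ) : Prop where
  two_le : 2 ≤ k
  two_le_degree : 2 ≤ d
  uniform : G.IsUniform k
  supertree : G.IsSupertree
  ground : G.IsGroundState k c f
  le_degree : ∀ v, G.IsInterior v → d ≤ G.degree v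
  exists_interior : ∃ v, G.IsInterior v
  le_energy : ∀ H : FinHypergraph V, H.IsCompetitor G k d →
    ∀ g : V → ℝ, (∀ v, G.IsBoundary v → g v = 0) → c * ∑ v, g v ^ 2 ≤ H.energy k g

namespace IsExtremal

variable {G H : FinHypergraph V} {k d : ℕ} {c : ℝ} {f : V → ℝ}

theorem nonneg (X : G.IsExtremal k d c f) (v : V) : 0 ≤ f v := by
  by_cases hv : G.IsBoundary v
  · exact (X.ground.zero v hv).ge
  · exact (X.ground.pos v hv).le

theorem isInterior_iff (X : G.IsExtremal k d c f) {v : V} : G.IsInterior v ↔ 0 < f v :=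
  ⟨X.ground.pos v, fun h hb => h.ne' (X.ground.zero v hb)⟩

theorem two_le_degree_of_pos (X : G.IsExtremal k d c f) {v : V} (hv : 0 < f v) : 2 ≤ G.degree v :=
  X.two_le_degree.trans (X.le_degree v (X.isInterior_iff.2 hv))

theorem exists_mem_ne (X : G.IsExtremal k d c f) {e : Finset V} (he : e ∈ G.edges) (v : V) :
    ∃ w ∈ e, w ≠ v :=
  Finset.exists_mem_ne (by rw [X.uniform e he]; exact X.two_le) v

theorem energy_eq (X : G.IsExtremal k d c f) : G.energy k f = c * ∑ v, f v ^ 2 :=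
  energy_eq_of_eigenfunction X.ground.zero X.ground.eigen

theorem eigenvalue_pos (X : G.IsExtremal k d c f) : 0 < c := by
  by_contra hc
  obtain ⟨v, hv⟩ := X.exists_interior
  have hpos := X.ground.pos v hv
  obtain ⟨e, he, -, -⟩ := exists_edge_ne (X.two_le_degree_of_pos hpos) ∅
  obtain ⟨w, -, hwv⟩ := X.exists_mem_ne he v
  have : Nontrivial V := ⟨w, v, hwv⟩
  obtain ⟨b, hb⟩ := X.supertree.exists_isBoundary X.uniform X.two_le
  have hconst := X.supertree.1.eq_of_energy_nonpos X.uniform (f := f)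
    (X.energy_eq ▸ mul_nonpos_of_nonpos_of_nonneg (not_lt.1 hc) (by positivity)) v b
  exact hpos.ne' (hconst.trans (X.ground.zero b hb))

theorem energy_le (X : G.IsExtremal k d c f) (hH : H.IsCompetitor G k d) :
    G.energy k f ≤ H.energy k f :=
  X.energy_eq ▸ X.le_energy H hH f X.ground.zero

theorem scaledLap_eq_of_energy_le (X : G.IsExtremal k d c f) (hH : H.IsCompetitor G k d)
    (hle : H.energy k f ≤ G.energy k f) {v : V} (hv : 0 < f v) :
    H.scaledLap k f v = G.scaledLap k f v := by
  have hint := X.isInterior_iff.2 hv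
  rw [X.ground.eigen v hint]
  exact FinHypergraph.scaledLap_eq_of_energy_le
    (fun g hg => X.le_energy H hH g fun w hw => hg w ((hH.isBoundary_iff w).2 hw))
    (fun w hw => X.ground.zero w ((hH.isBoundary_iff w).1 hw)) (hle.trans_eq X.energy_eq)
    (mt (hH.isBoundary_iff v).1 hint)

variable {e₁ e₂ : Finset V} {x₁ x₂ y₁ y₂ z₁ z₂ : V}

theorem isCompetitor_switch (X : G.IsExtremal k d c f) (S : G.Switchable e₁ z₁ e₂ z₂) :
    (G.switch e₁ z₁ e₂ z₂).IsCompetitor G k d where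
  uniform := S.isUniform_switch X.uniform
  supertree := S.isSupertree_switch X.supertree X.uniform
  isBoundary_iff v := by
    rw [IsBoundary, IsBoundary, S.degree_switch X.supertree X.uniform X.two_le]
  le_degree v hv := by
    rw [S.degree_switch X.supertree X.uniform X.two_le]
    exact X.le_degree v hv

theorem mul_nonneg_of_switchable (X : G.IsExtremal k d c f) (S : G.Switchable e₁ z₁ e₂ z₂) :
    0 ≤ (f z₁ - f z₂) * (∑ v ∈ e₁.erase z₁, f v - ∑ v ∈ e₂.erase z₂, f v) := by
  have hle := X.energy_le (X.isCompetitor_switch S)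
  rw [S.energy_switch X.supertree X.uniform X.two_le] at hle
  linarith

theorem scaledLap_switch_eq (X : G.IsExtremal k d c f) (S : G.Switchable e₁ z₁ e₂ z₂)
    (h : (f z₁ - f z₂) * (∑ v ∈ e₁.erase z₁, f v - ∑ v ∈ e₂.erase z₂, f v) = 0) {v : V}
    (hv : 0 < f v) : (G.switch e₁ z₁ e₂ z₂).scaledLap k f v = G.scaledLap k f v := by
  refine X.scaledLap_eq_of_energy_le (X.isCompetitor_switch S) ?_ hv
  rw [S.energy_switch X.supertree X.uniform X.two_le, h, mul_zero, add_zero]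

theorem sum_erase_eq_of_switchable (X : G.IsExtremal k d c f) (S : G.Switchable e₁ z₁ e₂ z₂)
    (heq : f z₁ = f z₂) (hpos : 0 < f z₁) : ∑ v ∈ e₁.erase z₁, f v = ∑ v ∈ e₂.erase z₂, f v := by
  have hlap := X.scaledLap_switch_eq S (by rw [heq, sub_self, zero_mul]) hpos
  rw [S.scaledLap_switch_left X.supertree X.uniform X.two_le] at hlap
  linarith

theorem eq_of_switchable (X : G.IsExtremal k d c f) (S : G.Switchable e₁ z₁ e₂ z₂)
    (heq : ∑ v ∈ e₁.erase z₁, f v = ∑ v ∈ e₂.erase z₂, f v) {w : V} (hw : w ∈ e₁) (hne : w ≠ z₁)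
    (hw₂ : w ∉ e₂) (hpos : 0 < f w) : f z₁ = f z₂ := by
  have hlap := X.scaledLap_switch_eq S (by rw [heq, sub_self, mul_zero]) hpos
  rw [S.scaledLap_switch_of_mem X.supertree X.uniform X.two_le f hw hne hw₂] at hlap
  linarith

theorem lt_of_gate_lt (X : G.IsExtremal k d c f) (g : G.Gate e₁ x₁ e₂ x₂) (hlt : f x₁ < f x₂)
    (hy₁ : y₁ ∈ e₁) (hne₁ : y₁ ≠ x₁) (hy₂ : y₂ ∈ e₂) (hne₂ : y₂ ≠ x₂) (hpos : 0 < f y₁) :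
    f y₁ < f y₂ := by
  by_contra! hle
  have S := g.switchable X.supertree.2 (ne_of_apply_ne f hlt.ne)
  have T := g.switchable_of_ne X.supertree.2 hy₁ hne₁ hy₂ hne₂
  have hsum : ∑ v ∈ e₁.erase x₁, f v < ∑ v ∈ e₂.erase x₂, f v := by
    refine lt_of_le_of_ne ?_ fun heq => hlt.ne
      (X.eq_of_switchable S heq hy₁ hne₁ (g.notMem_of_ne X.supertree.2 hy₁ hne₁) hpos)
    exact sub_nonpos.1 (nonpos_of_mul_nonneg_right (X.mul_nonneg_of_switchable S) (sub_neg.2 hlt))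
  rw [Finset.sum_erase_eq_sub g.mem_left, Finset.sum_erase_eq_sub g.mem_right] at hsum
  have hsum' : ∑ v ∈ e₁.erase y₁, f v < ∑ v ∈ e₂.erase y₂, f v := by
    rw [Finset.sum_erase_eq_sub hy₁, Finset.sum_erase_eq_sub hy₂]
    linarith
  have hge : f y₁ ≤ f y₂ :=
    sub_nonpos.1 (nonpos_of_mul_nonneg_left (X.mul_nonneg_of_switchable T) (sub_neg.2 hsum'))
  exact hsum'.ne (X.sum_erase_eq_of_switchable T (hge.antisymm hle) hpos)

theorem le_of_gate_lt (X : G.IsExtremal k d c f) (g : G.Gate e₁ x₁ e₂ x₂) (hlt : f x₁ < f x₂)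
    (hy₁ : y₁ ∈ e₁) (hne₁ : y₁ ≠ x₁) (hy₂ : y₂ ∈ e₂) (hne₂ : y₂ ≠ x₂) : f y₁ ≤ f y₂ := by
  rcases (X.nonneg y₁).lt_or_eq with hpos | hzero
  · exact (X.lt_of_gate_lt g hlt hy₁ hne₁ hy₂ hne₂ hpos).le
  · exact hzero ▸ X.nonneg y₂

theorem eq_of_gate_eq (X : G.IsExtremal k d c f) (g : G.Gate e₁ x₁ e₂ x₂) (hne : x₁ ≠ x₂)
    (heq : f x₁ = f x₂) (hpos : 0 < f x₁) (hy₁ : y₁ ∈ e₁) (hne₁ : y₁ ≠ x₁) (hy₂ : y₂ ∈ e₂)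
    (hne₂ : y₂ ≠ x₂) : f y₁ = f y₂ := by
  have hsum := X.sum_erase_eq_of_switchable (g.switchable X.supertree.2 hne) heq hpos
  rw [Finset.sum_erase_eq_sub g.mem_left, Finset.sum_erase_eq_sub g.mem_right] at hsum
  have hmul := X.mul_nonneg_of_switchable
    (g.switchable_of_ne X.supertree.2 hy₁ hne₁ hy₂ hne₂)
  rw [Finset.sum_erase_eq_sub hy₁, Finset.sum_erase_eq_sub hy₂] at hmul
  nlinarith [sq_nonneg (f y₁ - f y₂)]

theorem le_of_sum_le (X : G.IsExtremal k d c f) {x : V} (g : G.Gate e₁ x e₂ x)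
    (hle : ∑ v ∈ e₁, f v ≤ ∑ v ∈ e₂, f v) (hy₁ : y₁ ∈ e₁) (hne₁ : y₁ ≠ x) (hy₂ : y₂ ∈ e₂)
    (hne₂ : y₂ ≠ x) : f y₁ ≤ f y₂ := by
  have hmul := X.mul_nonneg_of_switchable
    (g.switchable_of_ne X.supertree.2 hy₁ hne₁ hy₂ hne₂)
  rw [Finset.sum_erase_eq_sub hy₁, Finset.sum_erase_eq_sub hy₂] at hmul
  by_contra! hlt
  nlinarith

end IsExtremal

end Extremal

section Monotone

variable {V : Type*} [DecidableEq V] {G : FinHypergraph V} {k d : ℕ} {c : ℝ} {f : V → ℝ} {r : V}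

namespace Rooting

variable {e₁ e₂ : Finset V}

theorem reachable_erase_erase (R : G.Rooting r) {v : V} (h₁ : G.dist v r ≤ G.dist (R.top e₁) r)
    (h₂ : G.dist v r ≤ G.dist (R.top e₂) r) :
    (twoSection ((G.edges.erase e₁).erase e₂)).Reachable v r := by
  refine (R.reachable_root v).mono (twoSection.mono fun e he => ?_)
  rw [Finset.mem_filter] at he
  refine Finset.mem_erase.2 ⟨?_, Finset.mem_erase.2 ⟨?_, he.1⟩⟩ <;> rintro rfl <;> omega

theorem gate_of_dist_eq (R : G.Rooting r) (h₁ : e₁ ∈ G.edges) (h₂ : e₂ ∈ G.edges) (hne : e₁ ≠ e₂)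
    (heq : G.dist (R.top e₁) r = G.dist (R.top e₂) r) : G.Gate e₁ (R.top e₁) e₂ (R.top e₂) :=
  ⟨h₁, h₂, hne, R.top_mem _ h₁, R.top_mem _ h₂,
    (R.reachable_erase_erase le_rfl heq.le).trans (R.reachable_erase_erase heq.ge le_rfl).symm⟩

theorem gate_of_dist_eq_succ (R : G.Rooting r) (h₁ : e₁ ∈ G.edges) (h₂ : e₂ ∈ G.edges)
    (heq : G.dist (R.top e₂) r = G.dist (R.top e₁) r + 1) (hmem : R.top e₂ ∉ e₁) :
    G.Gate e₁ (R.top e₁) e₂ (R.top e₂) := by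
  have hroot : R.top e₂ ≠ r := fun h => by
    rw [(R.dist_eq_zero_iff _).2 h] at heq
    omega
  have hparent := R.dist_eq_dist_parent_succ hroot
  have hrest : R.parentEdge (R.top e₂) ∈ (G.edges.erase e₁).erase e₂ := by
    refine Finset.mem_erase.2 ⟨fun h => ?_, Finset.mem_erase.2 ⟨fun h => ?_,
      R.parentEdge_mem _ hroot⟩⟩
    · rw [h] at hparent
      omega
    · exact hmem (h ▸ R.mem_parentEdge _ hroot)
  refine ⟨h₁, h₂, ?_, R.top_mem _ h₁, R.top_mem _ h₂, ?_⟩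
  · rintro rfl
    omega
  · exact (R.reachable_erase_erase le_rfl (by omega)).trans
      ((twoSection.reachable_of_mem hrest (R.mem_parentEdge _ hroot)
        (R.top_parentEdge_mem hroot)).trans
        (R.reachable_erase_erase (by omega) (by omega))).symm

theorem isInterior_top (R : G.Rooting r) (hr : G.IsInterior r) {e : Finset V} (he : e ∈ G.edges) :
    G.IsInterior (R.top e) := by
  by_cases htop : R.top e = r
  · rwa [htop]
  · refine isInterior_of_mem_of_mem he (R.parentEdge_mem _ htop) (R.top_mem e he)
      (R.mem_parentEdge _ htop) fun h => R.ne_top_parentEdge _ htop ?_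
    rw [← h]

end Rooting

variable [Fintype V]

namespace IsExtremal

theorem exists_top_eq (X : G.IsExtremal k d c f) (R : G.Rooting r) {v : V} (hv : 0 < f v) :
    ∃ e ∈ G.edges, R.top e = v := by
  obtain ⟨e, he, hve, hne⟩ := exists_edge_ne (X.two_le_degree_of_pos hv) (R.parentEdge v)
  exact ⟨e, he, (R.eq_top_of_ne_parentEdge he hve hne).symm⟩

theorem pos_root (X : G.IsExtremal k d c f) (hmax : ∀ v, f v ≤ f r) : 0 < f r := by
  obtain ⟨v, hv⟩ := X.exists_interior
  exact (X.ground.pos v hv).trans_le (hmax v)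

theorem pos_top (X : G.IsExtremal k d c f) (R : G.Rooting r) (hmax : ∀ v, f v ≤ f r)
    {e : Finset V} (he : e ∈ G.edges) : 0 < f (R.top e) :=
  X.isInterior_iff.1 (R.isInterior_top (X.isInterior_iff.2 (X.pos_root hmax)) he)

theorem le_of_reachable (X : G.IsExtremal k d c f) (R : G.Rooting r) (hmax : ∀ v, f v ≤ f r)
    {u w : V} (hle : G.dist u r ≤ G.dist w r)
    (hr : (twoSection (G.edges.filter fun e =>
      G.dist u r ≤ G.dist (R.top e) r ∧ G.dist (R.top e) r < G.dist w r)).Reachable u w) :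
    f w ≤ f u := by
  induction hm : G.dist u r generalizing u w with
  | zero => exact (R.dist_eq_zero_iff u).1 hm ▸ hmax w
  | succ m ih =>
    by_contra! hlt
    have hur : u ≠ r := fun h => by
      rw [(R.dist_eq_zero_iff u).2 h] at hm
      omega
    obtain ⟨e, he, rfl⟩ := X.exists_top_eq R ((X.nonneg u).trans_lt hlt)
    have hparent := R.dist_eq_dist_parent_succ hur
    have g : G.Gate (R.parentEdge u) u e (R.top e) := by
      refine ⟨R.parentEdge_mem u hur, he, ?_, R.mem_parentEdge u hur, R.top_mem _ he,
        hr.mono (twoSection.mono fun e' he' => ?_)⟩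
      · rintro rfl
        omega
      · rw [Finset.mem_filter] at he'
        refine Finset.mem_erase.2 ⟨?_, Finset.mem_erase.2 ⟨?_, he'.1⟩⟩ <;> rintro rfl <;> omega
    obtain ⟨y, hy, hyt⟩ := X.exists_mem_ne he (R.top e)
    have hdist := R.dist_eq_succ e he y hy hyt
    -- The reversed inequality would climb to the parent of `u` and descend to a child of `top e`.
    have hclimb := X.lt_of_gate_lt g hlt (R.top_parentEdge_mem hur)
      (R.ne_top_parentEdge u hur).symm hy hyt (X.pos_top R hmax (R.parentEdge_mem u hur))
    refine hclimb.not_ge (ih (by omega) ?_ (by omega))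
    refine (twoSection.reachable_of_mem (Finset.mem_filter.2 ⟨R.parentEdge_mem u hur, le_rfl,
      by omega⟩) (R.top_parentEdge_mem hur) (R.mem_parentEdge u hur)).trans <|
        (hr.mono (twoSection.mono fun e' he' => ?_)).trans <|
        twoSection.reachable_of_mem (Finset.mem_filter.2 ⟨he, by omega, by omega⟩)
          (R.top_mem _ he) hy
    rw [Finset.mem_filter] at he' ⊢
    exact ⟨he'.1, by omega, by omega⟩

theorem le_parent (X : G.IsExtremal k d c f) (R : G.Rooting r) (hmax : ∀ v, f v ≤ f r) {v : V}
    (hv : v ≠ r) : f v ≤ f (R.top (R.parentEdge v)) := by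
  have hparent := R.dist_eq_dist_parent_succ hv
  exact X.le_of_reachable R hmax (by omega) (twoSection.reachable_of_mem
    (Finset.mem_filter.2 ⟨R.parentEdge_mem v hv, le_rfl, by omega⟩)
    (R.top_parentEdge_mem hv) (R.mem_parentEdge v hv))

theorem le_of_parent_mem (X : G.IsExtremal k d c f) (R : G.Rooting r) (hmax : ∀ v, f v ≤ f r)
    {u w : V} (hu : u ≠ r) (hw : w ≠ r) (hmem : R.top (R.parentEdge w) ∈ R.parentEdge u)
    (hne : R.top (R.parentEdge w) ≠ R.top (R.parentEdge u)) : f w ≤ f u := by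
  by_cases hpu : R.top (R.parentEdge w) = u
  · exact hpu ▸ X.le_parent R hmax hw
  by_contra! hlt
  set e := R.parentEdge u
  set p := R.top (R.parentEdge w)
  have he : e ∈ G.edges := R.parentEdge_mem u hu
  have hew : e ≠ R.parentEdge w := fun h => hne (congrArg R.top h.symm)
  have hedist := R.dist_eq_succ e he p hmem hne
  have hwdist : G.dist w r = G.dist p r + 1 := R.dist_eq_dist_parent_succ hw
  have g : G.Gate e p (R.parentEdge w) p :=
    ⟨he, R.parentEdge_mem w hw, hew, hmem, R.top_parentEdge_mem hw, .refl _⟩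
  have htop_le : f (R.top e) ≤ f w := by
    rcases le_total (∑ v ∈ e, f v) (∑ v ∈ R.parentEdge w, f v) with hs | hs
    · exact X.le_of_sum_le g hs (R.top_mem e he) hne.symm (R.mem_parentEdge w hw)
        (R.ne_top_parentEdge w hw)
    · exact absurd (X.le_of_sum_le g.symm hs (R.mem_parentEdge w hw) (R.ne_top_parentEdge w hw)
        (R.mem_parentEdge u hu) (Ne.symm hpu)) hlt.not_ge
  have hwp : f w ≤ f p := X.le_parent R hmax hw
  have hptop : f p ≤ f (R.top e) := by
    have h := X.le_parent R hmax (R.ne_root_of_ne_top he hmem hne)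
    rwa [← R.eq_parentEdge e he p hmem hne] at h
  obtain ⟨e', he', htop⟩ := X.exists_top_eq R ((X.nonneg u).trans_lt hlt)
  have g' : G.Gate e p e' w := by
    refine ⟨he, he', ?_, hmem, htop ▸ R.top_mem e' he', twoSection.reachable_of_mem
      (Finset.mem_erase.2 ⟨?_, Finset.mem_erase.2 ⟨hew.symm, R.parentEdge_mem w hw⟩⟩)
      (R.top_parentEdge_mem hw) (R.mem_parentEdge w hw)⟩
    · exact fun h => by
        rw [h, htop] at hedist
        omega
    · exact fun h => R.ne_top_parentEdge w hw (h ▸ htop.symm)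
  obtain ⟨y, hy, hyw⟩ := X.exists_mem_ne he' w
  have hconst : ∀ z ∈ e, z ≠ p → f z = f y := fun z hz hzp =>
    X.eq_of_gate_eq g' (R.ne_top_parentEdge w hw).symm (by linarith)
      (X.pos_top R hmax (R.parentEdge_mem w hw)) hz hzp hy hyw
  have hu_eq := hconst u (R.mem_parentEdge u hu) (Ne.symm hpu)
  have htop_eq := hconst (R.top e) (R.top_mem e he) hne.symm
  linarith

theorem le_of_dist_eq_succ (X : G.IsExtremal k d c f) (R : G.Rooting r) (hmax : ∀ v, f v ≤ f r)
    {u w : V} (h : G.dist w r = G.dist u r + 1) : f w ≤ f u := by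
  induction hm : G.dist u r generalizing u w with
  | zero => exact (R.dist_eq_zero_iff u).1 hm ▸ hmax w
  | succ m ih =>
    have hu : u ≠ r := fun h₀ => by
      rw [(R.dist_eq_zero_iff u).2 h₀] at hm
      omega
    have hw : w ≠ r := fun h₀ => by
      rw [(R.dist_eq_zero_iff w).2 h₀] at h
      omega
    have hpu := R.dist_eq_dist_parent_succ hu
    have hpw := R.dist_eq_dist_parent_succ hw
    have hne : R.top (R.parentEdge w) ≠ R.top (R.parentEdge u) := fun h₀ => by
      rw [h₀] at hpw
      omega
    by_cases hmem : R.top (R.parentEdge w) ∈ R.parentEdge u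
    · exact X.le_of_parent_mem R hmax hu hw hmem hne
    have g := R.gate_of_dist_eq_succ (R.parentEdge_mem u hu) (R.parentEdge_mem w hw) (by omega) hmem
    rcases (ih (w := R.top (R.parentEdge w)) (u := R.top (R.parentEdge u)) (by omega)
      (by omega)).lt_or_eq with hlt | heq
    · exact X.le_of_gate_lt g.symm hlt (R.mem_parentEdge w hw) (R.ne_top_parentEdge w hw)
        (R.mem_parentEdge u hu) (R.ne_top_parentEdge u hu)
    · exact (X.eq_of_gate_eq g hne.symm heq.symm (X.pos_top R hmax (R.parentEdge_mem u hu))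
        (R.mem_parentEdge u hu) (R.ne_top_parentEdge u hu) (R.mem_parentEdge w hw)
        (R.ne_top_parentEdge w hw)).ge

theorem le_of_dist_lt (X : G.IsExtremal k d c f) (R : G.Rooting r) (hmax : ∀ v, f v ≤ f r)
    {u w : V} (h : G.dist u r < G.dist w r) : f w ≤ f u := by
  induction hm : G.dist w r generalizing w with
  | zero => omega
  | succ m ih =>
    have hw : w ≠ r := fun h₀ => by
      rw [(R.dist_eq_zero_iff w).2 h₀] at h
      omega
    have hpw := R.dist_eq_dist_parent_succ hw
    rcases Nat.lt_or_ge (G.dist u r) (G.dist (R.top (R.parentEdge w)) r) with hlt | hge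
    · exact (X.le_parent R hmax hw).trans (ih hlt (by omega))
    · exact X.le_of_dist_eq_succ R hmax (by omega)

end IsExtremal

end Monotone

section Rank

variable {α β : Type*} [Fintype α] [LinearOrder β]

/-- The position of `a` when the elements of `α` are sorted by their values under `g`, starting
from `0`; elements with the same value have the same position. -/
def rank (g : α → β) (a : α) : ℕ :=
  (Finset.univ.filter fun b => g b < g a).card

theorem rank_lt_rank_iff {g : α → β} {a b : α} : rank g a < rank g b ↔ g a < g b := by
  constructor
  · contrapose!
    intro h
    exact Finset.card_le_card (Finset.monotone_filter_right _ fun _ _ hx => hx.trans_le h)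
  · intro h
    refine Finset.card_lt_card (Finset.ssubset_iff_of_subset
      (Finset.monotone_filter_right _ fun _ _ hx => hx.trans h) |>.2 ⟨a, ?_, ?_⟩)
    · simpa using h
    · simp

theorem rank_eq_rank_iff {g : α → β} {a b : α} : rank g a = rank g b ↔ g a = g b := by
  simp only [eq_iff_le_not_lt, ← not_lt, rank_lt_rank_iff]

/-- The position of `a` in an enumeration of `α` along which `g` is non-increasing; ties are
broken arbitrarily. -/
noncomputable def descRank (g : α → β) : α → ℕ :=
  rank fun a => toLex (OrderDual.toDual (g a), Fintype.equivFin α a)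

theorem descRank_injective (g : α → β) : Function.Injective (descRank g) := fun _ _ h =>
  (Fintype.equivFin α).injective (congrArg (fun x => (ofLex x).2) (rank_eq_rank_iff.1 h))

theorem le_of_descRank_lt {g : α → β} {a b : α} (h : descRank g a < descRank g b) : g b ≤ g a := by
  rcases (Prod.Lex.toLex_lt_toLex.1 (rank_lt_rank_iff.1 h)) with h | ⟨h, -⟩
  · exact h.le
  · exact (congrArg OrderDual.ofDual h).ge

end Rank

section Spiral

variable {V : Type*} {G : FinHypergraph V} {r : V} {f : V → ℝ}

namespace Rooting

/-- A numbering of the vertices in spiral order along which `f` is non-increasing. With `f = 0` it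
is a spiral order alone: conditions (S1), (S2) and (S4) of a spiral-like ordering. -/
structure IsSpiralCode (R : G.Rooting r) (f : V → ℝ) (code : V → ℕ) : Prop where
  injective : Function.Injective code
  lt_of_dist_lt : ∀ u v, G.dist u r < G.dist v r → code u < code v
  le_of_lt : ∀ u v, code u < code v → f v ≤ f u
  children : ∀ u v, u ≠ r → v ≠ r →
    code (R.top (R.parentEdge u)) < code (R.top (R.parentEdge v)) → code u < code v
  parentEdge_eq : ∀ u v w, u ≠ r → v ≠ r → w ≠ r → R.parentEdge u = R.parentEdge w →
    code u < code v → code v < code w → R.parentEdge v = R.parentEdge u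

variable [Fintype V]

/-- The rank of a vertex of height `m` among the vertices of this height, sorted by the ranks of
the parents, then by the sums of `f` over the parent edges, then by the values of `f`. -/
noncomputable def levelRank (R : G.Rooting r) (f : V → ℝ) : ℕ → V → ℕ
  | 0 => 0
  | m + 1 => rank fun v => toLex (levelRank R f m (R.top (R.parentEdge v)),
      toLex (descRank (fun e : Finset V => ∑ w ∈ e, f w) (R.parentEdge v), descRank f v))

/-- The spiral numbering of the vertices, by height and then by `levelRank`. -/
noncomputable def spiralCode (R : G.Rooting r) (f : V → ℝ) : V → ℕ :=
  rank fun v => toLex (G.dist v r, R.levelRank f (G.dist v r) v)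

theorem spiralCode_lt_iff (R : G.Rooting r) {u v : V} :
    R.spiralCode f u < R.spiralCode f v ↔ G.dist u r < G.dist v r ∨
      G.dist u r = G.dist v r ∧ R.levelRank f (G.dist u r) u < R.levelRank f (G.dist v r) v :=
  rank_lt_rank_iff.trans Prod.Lex.toLex_lt_toLex

theorem spiralCode_eq_iff (R : G.Rooting r) {u v : V} :
    R.spiralCode f u = R.spiralCode f v ↔
      G.dist u r = G.dist v r ∧ R.levelRank f (G.dist u r) u = R.levelRank f (G.dist v r) v :=
  rank_eq_rank_iff.trans (toLex_inj.trans Prod.ext_iff)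

theorem spiralCode_lt_iff_of_ne (R : G.Rooting r) {u v : V} (hu : u ≠ r) (hv : v ≠ r) :
    R.spiralCode f u < R.spiralCode f v ↔
      R.spiralCode f (R.top (R.parentEdge u)) < R.spiralCode f (R.top (R.parentEdge v)) ∨
      R.spiralCode f (R.top (R.parentEdge u)) = R.spiralCode f (R.top (R.parentEdge v)) ∧
        (descRank (fun e : Finset V => ∑ w ∈ e, f w) (R.parentEdge u) <
            descRank (fun e : Finset V => ∑ w ∈ e, f w) (R.parentEdge v) ∨
          R.parentEdge u = R.parentEdge v ∧ descRank f u < descRank f v) := by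
  rw [R.spiralCode_lt_iff, R.spiralCode_lt_iff, R.spiralCode_eq_iff,
    R.dist_eq_dist_parent_succ hu, R.dist_eq_dist_parent_succ hv, levelRank, levelRank,
    add_lt_add_iff_right, add_left_inj,
    ← (descRank_injective fun e : Finset V => ∑ w ∈ e, f w).eq_iff (a := R.parentEdge u)]
  by_cases h : G.dist (R.top (R.parentEdge u)) r = G.dist (R.top (R.parentEdge v)) r
  · rw [h, rank_lt_rank_iff, Prod.Lex.toLex_lt_toLex, Prod.Lex.toLex_lt_toLex]
    simp only [lt_irrefl, true_and, false_or]
  · simp only [h, false_and, or_false]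

theorem spiralCode_injective (R : G.Rooting r) (f : V → ℝ) :
    Function.Injective (R.spiralCode f) := by
  intro u v h
  obtain ⟨hdist, hlevel⟩ := R.spiralCode_eq_iff.1 h
  rw [← hdist] at hlevel
  cases hm : G.dist u r with
  | zero => rw [(R.dist_eq_zero_iff u).1 hm, (R.dist_eq_zero_iff v).1 (hdist ▸ hm)]
  | succ m =>
    rw [hm, levelRank, rank_eq_rank_iff] at hlevel
    exact descRank_injective f (congrArg (fun x => (ofLex (ofLex x).2).2) hlevel)

end Rooting

variable [Fintype V] [DecidableEq V] {k d : ℕ} {c : ℝ}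

theorem IsExtremal.le_of_spiralCode_lt (X : G.IsExtremal k d c f) (R : G.Rooting r)
    (hmax : ∀ v, f v ≤ f r) {u v : V} (huv : R.spiralCode f u < R.spiralCode f v) : f v ≤ f u := by
  induction hm : G.dist u r generalizing u v with
  | zero => exact (R.dist_eq_zero_iff u).1 hm ▸ hmax v
  | succ m ih =>
    rcases R.spiralCode_lt_iff.1 huv with hlt | ⟨hdist, -⟩
    · exact X.le_of_dist_lt R hmax hlt
    have hu : u ≠ r := fun h => by
      rw [(R.dist_eq_zero_iff u).2 h] at hm
      omega
    have hv : v ≠ r := fun h => by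
      rw [(R.dist_eq_zero_iff v).2 h] at hdist
      omega
    have hpu := R.dist_eq_dist_parent_succ hu
    have hpv := R.dist_eq_dist_parent_succ hv
    have hgate := fun hne => R.gate_of_dist_eq (R.parentEdge_mem u hu) (R.parentEdge_mem v hv) hne
      (by omega)
    rcases (R.spiralCode_lt_iff_of_ne hu hv).1 huv with hlt | ⟨heq, hlt | ⟨-, hlt⟩⟩
    · have hne : R.top (R.parentEdge u) ≠ R.top (R.parentEdge v) := ne_of_apply_ne _ hlt.ne
      have g := hgate (ne_of_apply_ne _ hne)
      rcases (ih hlt (by omega)).lt_or_eq with hflt | hfeq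
      · exact X.le_of_gate_lt g.symm hflt (R.mem_parentEdge v hv) (R.ne_top_parentEdge v hv)
          (R.mem_parentEdge u hu) (R.ne_top_parentEdge u hu)
      · exact (X.eq_of_gate_eq g hne hfeq.symm (X.pos_top R hmax (R.parentEdge_mem u hu))
          (R.mem_parentEdge u hu) (R.ne_top_parentEdge u hu) (R.mem_parentEdge v hv)
          (R.ne_top_parentEdge v hv)).ge
    · have htop := R.spiralCode_injective f heq
      have g := hgate (ne_of_apply_ne _ hlt.ne)
      rw [htop] at g
      exact X.le_of_sum_le g.symm (le_of_descRank_lt hlt) (R.mem_parentEdge v hv)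
        (R.ne_top_parentEdge v hv) (R.mem_parentEdge u hu) (htop ▸ R.ne_top_parentEdge u hu)
    · exact le_of_descRank_lt hlt

theorem IsExtremal.isSpiralCode (X : G.IsExtremal k d c f) (R : G.Rooting r)
    (hmax : ∀ v, f v ≤ f r) : R.IsSpiralCode f (R.spiralCode f) where
  injective := R.spiralCode_injective f
  lt_of_dist_lt _ _ h := R.spiralCode_lt_iff.2 (.inl h)
  le_of_lt _ _ h := X.le_of_spiralCode_lt R hmax h
  children _ _ hu hv h := (R.spiralCode_lt_iff_of_ne hu hv).2 (.inl h)
  parentEdge_eq u v w hu hv hw huw huv hvw := by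
    rw [R.spiralCode_lt_iff_of_ne hu hv] at huv
    rw [R.spiralCode_lt_iff_of_ne hv hw, ← huw] at hvw
    by_contra hne
    simp only [hne, Ne.symm hne, false_and, or_false] at huv hvw
    omega

end Spiral

section Shift

variable {V : Type*} [DecidableEq V]

/-- The hypergraph in which the edge `e` of `G` contains `v` in place of its vertex `u`. -/
def shift (G : FinHypergraph V) (e : Finset V) (u v : V) : FinHypergraph V where
  edges := insert (insert v (e.erase u)) (G.edges.erase e)
  nonempty_of_mem e' he' := by
    rcases Finset.mem_insert.1 he' with rfl | he'
    · exact Finset.insert_nonempty _ _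
    · exact G.nonempty_of_mem e' (Finset.mem_of_mem_erase he')

/-- The edge `e` can be moved from its vertex `u` to the vertex `v` without disconnecting `G`:
`u` and `v` are joined by the other edges. -/
structure Shiftable (G : FinHypergraph V) (e : Finset V) (u v : V) : Prop where
  mem : e ∈ G.edges
  mem_left : u ∈ e
  notMem_right : v ∉ e
  reachable : (twoSection (G.edges.erase e)).Reachable u v

namespace Shiftable

variable {G : FinHypergraph V} {e : Finset V} {u v : V} {k : ℕ}

theorem ne (S : G.Shiftable e u v) : u ≠ v :=
  fun h => S.notMem_right (h ▸ S.mem_left)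

theorem notMem_erase (S : G.Shiftable e u v) : v ∉ e.erase u :=
  fun h => S.notMem_right (Finset.mem_of_mem_erase h)

theorem isUniform_shift (S : G.Shiftable e u v) (hG : G.IsUniform k) :
    (G.shift e u v).IsUniform k := by
  intro e' he'
  rcases Finset.mem_insert.1 he' with rfl | he'
  · rw [Finset.card_insert_of_notMem S.notMem_erase, Finset.card_erase_add_one S.mem_left,
      hG e S.mem]
  · exact hG e' (Finset.mem_of_mem_erase he')

theorem isSupertree_shift [Finite V] (S : G.Shiftable e u v) (hG : G.IsSupertree)
    (hu : G.IsUniform k) : (G.shift e u v).IsSupertree := by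
  set H := G.shift e u v
  have hrest : G.edges.erase e ⊆ H.edges := Finset.subset_insert _ _
  have hreach : ∀ w ∈ e, (twoSection H.edges).Reachable w v := by
    intro w hw
    by_cases hwu : w = u
    · exact hwu ▸ S.reachable.mono (twoSection.mono hrest)
    · exact twoSection.reachable_of_mem (Finset.mem_insert_self _ _)
        (Finset.mem_insert_of_mem (Finset.mem_erase.2 ⟨hwu, hw⟩)) (Finset.mem_insert_self _ _)
  have hcard : H.edges.card ≤ G.edges.card :=
    (Finset.card_insert_le _ _).trans_eq (Finset.card_erase_add_one S.mem)
  refine hG.of_card_edges_le hu (S.isUniform_shift hu) hcard fun e' he' x hx y hy => ?_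
  by_cases hee : e' = e
  · subst hee
    exact (hreach x hx).trans (hreach y hy).symm
  · exact twoSection.reachable_of_mem (hrest (Finset.mem_erase.2 ⟨hee, he'⟩)) hx hy

theorem sum_edges_shift [Finite V] {M : Type*} [AddCommMonoid M] (S : G.Shiftable e u v)
    (hG : G.IsSupertree) (hu : G.IsUniform k) (hk : 2 ≤ k) (φ : Finset V → M) :
    ∑ e' ∈ (G.shift e u v).edges, φ e' =
      φ (insert v (e.erase u)) + ∑ e' ∈ G.edges.erase e, φ e' := by
  have := Fintype.ofFinite V
  refine Finset.sum_insert fun h => ?_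
  have hcard := (S.isSupertree_shift hG hu).card_eq_of_isUniform (S.isUniform_shift hu)
  rw [hG.card_eq_of_isUniform hu] at hcard
  have hcard' : G.edges.card = (insert (insert v (e.erase u)) (G.edges.erase e)).card :=
    Nat.eq_of_mul_eq_mul_right (by omega) (Nat.add_left_cancel hcard)
  rw [Finset.insert_eq_of_mem h] at hcard'
  exact (Finset.card_erase_lt_of_mem S.mem).ne' hcard'

theorem sum_insert_erase (S : G.Shiftable e u v) (g : V → ℝ) :
    ∑ w ∈ insert v (e.erase u), g w = ∑ w ∈ e, g w - g u + g v := by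
  rw [Finset.sum_insert S.notMem_erase, Finset.sum_erase_eq_sub S.mem_left, add_comm]

variable [Finite V]

theorem degree_shift_left (S : G.Shiftable e u v) (hG : G.IsSupertree) (hu : G.IsUniform k)
    (hk : 2 ≤ k) : (G.shift e u v).degree u + 1 = G.degree u := by
  rw [degree, degree, Finset.card_filter, Finset.card_filter, S.sum_edges_shift hG hu hk,
    ← Finset.add_sum_erase _ _ S.mem, if_pos S.mem_left, if_neg (by simp [S.ne])]
  omega

theorem degree_shift_right (S : G.Shiftable e u v) (hG : G.IsSupertree) (hu : G.IsUniform k)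
    (hk : 2 ≤ k) : (G.shift e u v).degree v = G.degree v + 1 := by
  rw [degree, degree, Finset.card_filter, Finset.card_filter, S.sum_edges_shift hG hu hk,
    ← Finset.add_sum_erase _ _ S.mem, if_neg S.notMem_right, if_pos (Finset.mem_insert_self _ _)]
  omega

theorem degree_shift_of_ne (S : G.Shiftable e u v) (hG : G.IsSupertree) (hu : G.IsUniform k)
    (hk : 2 ≤ k) {w : V} (hwu : w ≠ u) (hwv : w ≠ v) :
    (G.shift e u v).degree w = G.degree w := by
  rw [degree, degree, Finset.card_filter, Finset.card_filter, S.sum_edges_shift hG hu hk,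
    ← Finset.add_sum_erase _ _ S.mem]
  simp [hwu, hwv]

theorem energy_shift (S : G.Shiftable e u v) (hG : G.IsSupertree) (hu : G.IsUniform k)
    (hk : 2 ≤ k) (f : V → ℝ) :
    (G.shift e u v).energy k f = G.energy k f -
      (f u - f v) * ((k - 1) * (f u + f v) - 2 * ∑ w ∈ e.erase u, f w) := by
  rw [energy, energy, S.sum_edges_shift hG hu hk, ← Finset.add_sum_erase _ _ S.mem,
    S.sum_insert_erase f, S.sum_insert_erase, Finset.sum_erase_eq_sub S.mem_left]
  ring

theorem scaledLap_shift_left (S : G.Shiftable e u v) (hG : G.IsSupertree) (hu : G.IsUniform k)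
    (hk : 2 ≤ k) (f : V → ℝ) :
    (G.shift e u v).scaledLap k f u = G.scaledLap k f u - (k * f u - ∑ w ∈ e, f w) := by
  rw [scaledLap, scaledLap, Finset.sum_filter, Finset.sum_filter, S.sum_edges_shift hG hu hk,
    ← Finset.add_sum_erase _ _ S.mem, if_pos S.mem_left, if_neg (by simp [S.ne])]
  ring

end Shiftable

variable [Fintype V] {G : FinHypergraph V} {k d : ℕ} {c : ℝ} {f : V → ℝ} {e : Finset V} {u v : V}

theorem IsExtremal.isCompetitor_shift (X : G.IsExtremal k d c f) (S : G.Shiftable e u v)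
    (hdeg : d < G.degree u) (hv : G.IsInterior v) : (G.shift e u v).IsCompetitor G k d := by
  have hleft := S.degree_shift_left X.supertree X.uniform X.two_le
  have hright := S.degree_shift_right X.supertree X.uniform X.two_le
  have hd := X.two_le_degree
  have hdv := X.le_degree v hv
  have hdegree : ∀ w, (G.shift e u v).degree w = G.degree w ∨
      d ≤ G.degree w ∧ d ≤ (G.shift e u v).degree w := by
    intro w
    rcases eq_or_ne w u with rfl | hwu
    · omega
    rcases eq_or_ne w v with rfl | hwv
    · omega
    exact .inl (S.degree_shift_of_ne X.supertree X.uniform X.two_le hwu hwv)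
  refine ⟨S.isUniform_shift X.uniform, S.isSupertree_shift X.supertree X.uniform,
    fun w => ?_, fun w hw => ?_⟩
  · rw [IsBoundary, IsBoundary]
    have := hdegree w
    omega
  · have := hdegree w
    have := X.le_degree w hw
    omega

theorem IsExtremal.eq_of_shiftable (X : G.IsExtremal k d c f) (S : G.Shiftable e u v)
    (hdeg : d < G.degree u) (hv : 0 < f v) (huv : f v ≤ f u)
    (hle : ∀ w ∈ e, w ≠ u → f w ≤ f v) {w : V} (hw : w ∈ e) : f w = f u := by
  have hcard : (k : ℝ) - 1 = (e.erase u).card := by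
    rw [← X.uniform e S.mem, ← Finset.card_erase_add_one S.mem_left]
    simp
  have hsum : ∑ w ∈ e.erase u, f w ≤ (k - 1) * f v := by
    rw [hcard, ← nsmul_eq_mul]
    exact Finset.sum_le_card_nsmul _ _ _ fun w hw =>
      hle w (Finset.mem_of_mem_erase hw) (Finset.ne_of_mem_erase hw)
  have henergy : (G.shift e u v).energy k f ≤ G.energy k f := by
    rw [S.energy_shift X.supertree X.uniform X.two_le, sub_le_self_iff]
    have := mul_nonneg (hcard ▸ Nat.cast_nonneg (e.erase u).card) (sub_nonneg.2 huv)
    exact mul_nonneg (sub_nonneg.2 huv) (by linarith)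
  have hlap := X.scaledLap_eq_of_energy_le (X.isCompetitor_shift S hdeg (X.isInterior_iff.2 hv))
    henergy (hv.trans_le huv)
  rw [S.scaledLap_shift_left X.supertree X.uniform X.two_le] at hlap
  have hzero : ∑ w ∈ e, (f u - f w) = 0 := by
    rw [Finset.sum_sub_distrib, Finset.sum_const, X.uniform e S.mem, nsmul_eq_mul]
    linarith
  refine (sub_eq_zero.1 ((Finset.sum_eq_zero_iff_of_nonneg fun w hw => ?_).1 hzero w hw)).symm
  by_cases hwu : w = u
  · rw [hwu, sub_self]
  · exact sub_nonneg.2 ((hle w hw hwu).trans huv)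

end Shift

section SpiralOrder

variable {V : Type*} {G : FinHypergraph V} {r : V} {R : G.Rooting r} {f : V → ℝ} {code : V → ℕ}

namespace Rooting

namespace IsSpiralCode

theorem dist_le_of_le (C : R.IsSpiralCode f code) {u v : V} (h : code u ≤ code v) :
    G.dist u r ≤ G.dist v r :=
  not_lt.1 fun hlt => (C.lt_of_dist_lt v u hlt).not_ge h

theorem le_of_le (C : R.IsSpiralCode f code) {u v : V} (h : code u ≤ code v) : f v ≤ f u := by
  rcases h.lt_or_eq with hlt | heq
  · exact C.le_of_lt u v hlt
  · exact (congrArg f (C.injective heq)).ge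

theorem ne_top_of_lt (C : R.IsSpiralCode f code) {e : Finset V} (he : e ∈ G.edges) {v w : V}
    (hv : v ∈ e) (h : code v < code w) : w ≠ R.top e := by
  rintro rfl
  have hdist := R.dist_eq_succ e he v hv (ne_of_apply_ne code h.ne)
  have := C.dist_le_of_le h.le
  omega

theorem edge_consecutive (C : R.IsSpiralCode f code) {e : Finset V} (he : e ∈ G.edges)
    {a b c v : V} (ha : a ∈ e) (hb : b ∈ e) (hc : c ∈ e) (hab : code a < code b)
    (hbv : code b < code v) (hvc : code v < code c) : v ∈ e := by
  have hbt := C.ne_top_of_lt he ha hab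
  have hct := C.ne_top_of_lt he hb (hbv.trans hvc)
  have hbr := R.ne_root_of_ne_top he hb hbt
  have hcr := R.ne_root_of_ne_top he hc hct
  have hpb := R.eq_parentEdge e he b hb hbt
  have hpc := R.eq_parentEdge e he c hc hct
  have hvr : v ≠ r := by
    rintro rfl
    have := C.dist_le_of_le hbv.le
    rw [(R.dist_eq_zero_iff v).2 rfl, Nat.le_zero, R.dist_eq_zero_iff] at this
    exact hbr this
  have hpv := C.parentEdge_eq b v c hbr hvr hcr (hpb.symm.trans hpc) hbv hvc
  rw [hpb, ← hpv]
  exact R.mem_parentEdge v hvr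

theorem le_last_child (C : R.IsSpiralCode f code) {u w x : V} (hw : w ≠ r)
    (hwu : R.top (R.parentEdge w) = u)
    (hlast : ∀ y, y ≠ r → R.top (R.parentEdge y) = u → code y ≤ code w)
    {e : Finset V} (he : e ∈ G.edges) (hu : u ∈ e) (hx : x ∈ e) : code x ≤ code w := by
  have hdist := R.dist_eq_dist_parent_succ hw
  rw [hwu] at hdist
  by_cases hxt : x = R.top e
  · refine (C.lt_of_dist_lt x w ?_).le
    rw [hxt]
    have := R.dist_top_le he hu
    omega
  by_cases hut : u = R.top e
  · exact hlast x (R.ne_root_of_ne_top he hx hxt) (by rw [← R.eq_parentEdge e he x hx hxt, hut])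
  · refine (C.lt_of_dist_lt x w ?_).le
    have := R.dist_eq_succ e he u hu hut
    have := R.dist_eq_succ e he x hx hxt
    omega

end IsSpiralCode

variable [DecidableEq V]

theorem shiftable (R : G.Rooting r) {w v : V} (hw : w ≠ r) (hv : v ∉ R.parentEdge w)
    (hdist : G.dist v r ≤ G.dist w r) :
    G.Shiftable (R.parentEdge w) (R.top (R.parentEdge w)) v := by
  have hsucc := R.dist_eq_dist_parent_succ hw
  have hlow : ∀ x, G.dist x r ≤ G.dist (R.top (R.parentEdge w)) r →
      (twoSection (G.edges.erase (R.parentEdge w))).Reachable x r := by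
    refine fun x hx => (R.reachable_root x).mono (twoSection.mono fun e he => ?_)
    rw [Finset.mem_filter] at he
    refine Finset.mem_erase.2 ⟨?_, he.1⟩
    rintro rfl
    omega
  refine ⟨R.parentEdge_mem w hw, R.top_parentEdge_mem hw, hv, (hlow _ le_rfl).trans ?_⟩
  by_cases hv' : G.dist v r ≤ G.dist (R.top (R.parentEdge w)) r
  · exact (hlow v hv').symm
  have hvr : v ≠ r := fun h => hv' (by rw [(R.dist_eq_zero_iff v).2 h]; exact Nat.zero_le _)
  have hvsucc := R.dist_eq_dist_parent_succ hvr
  have hne : R.parentEdge v ≠ R.parentEdge w := fun h => hv (h ▸ R.mem_parentEdge v hvr)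
  exact (hlow _ (by omega)).symm.trans (twoSection.reachable_of_mem
    (Finset.mem_erase.2 ⟨hne, R.parentEdge_mem v hvr⟩) (R.top_parentEdge_mem hvr)
    (R.mem_parentEdge v hvr))

theorem exists_top_eq_ne (R : G.Rooting r) {u : V} (hu : 3 ≤ G.degree u) (e : Finset V) :
    ∃ e' ∈ G.edges, R.top e' = u ∧ e' ≠ e := by
  obtain ⟨e', he', hne⟩ : ∃ e' ∈ G.edges.filter (fun e => u ∈ e),
      e' ∉ ({R.parentEdge u, e} : Finset (Finset V)) :=
    Finset.exists_mem_notMem_of_card_lt_card (Finset.card_le_two.trans_lt hu)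
  rw [Finset.mem_filter] at he'
  simp only [Finset.mem_insert, Finset.mem_singleton, not_or] at hne
  exact ⟨e', he'.1, (R.eq_top_of_ne_parentEdge he'.1 he'.2 hne.1).symm, hne.2⟩

end Rooting

variable [Fintype V] [DecidableEq V] {k d : ℕ} {c : ℝ}

namespace IsExtremal

theorem exists_last_child (X : G.IsExtremal k d c f) (R : G.Rooting r) (code : V → ℕ) {u : V}
    (hu : 0 < f u) : ∃ w ≠ r, R.top (R.parentEdge w) = u ∧
      ∀ y, y ≠ r → R.top (R.parentEdge y) = u → code y ≤ code w := by
  classical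
  obtain ⟨e, he, rfl⟩ := X.exists_top_eq R hu
  obtain ⟨y, hy, hyt⟩ := X.exists_mem_ne he (R.top e)
  obtain ⟨w, hw, hmax⟩ := (Finset.univ.filter fun w =>
    w ≠ r ∧ R.top (R.parentEdge w) = R.top e).exists_max_image code
      ⟨y, by simp [R.ne_root_of_ne_top he hy hyt, ← R.eq_parentEdge e he y hy hyt]⟩
  simp only [Finset.mem_filter, Finset.mem_univ, true_and] at hw hmax
  exact ⟨w, hw.1, hw.2, fun y hy hyu => hmax y ⟨hy, hyu⟩⟩

theorem ne_last_child (X : G.IsExtremal k d c f) (C : R.IsSpiralCode f code) {u w : V}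
    (hu : G.IsInterior u) (hw : w ≠ r) (hwu : R.top (R.parentEdge w) = u)
    (hlast : ∀ y, y ≠ r → R.top (R.parentEdge y) = u → code y ≤ code w) : f w ≠ f u := by
  intro heq
  have hlap : G.scaledLap k f u ≤ 0 := by
    refine Finset.sum_nonpos fun e he => ?_
    rw [Finset.mem_filter] at he
    rw [← heq, sub_nonpos, ← X.uniform e he.1, ← nsmul_eq_mul]
    exact Finset.card_nsmul_le_sum _ _ _ fun x hx =>
      C.le_of_le (C.le_last_child hw hwu hlast he.1 he.2 hx)
  rw [X.ground.eigen u hu] at hlap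
  exact hlap.not_gt (mul_pos X.eigenvalue_pos (X.isInterior_iff.1 hu))

theorem code_le_of_top_eq (X : G.IsExtremal k d c f) (C : R.IsSpiralCode f code) {u v : V}
    (hv : G.IsInterior v) (hnext : ∀ w, G.IsInterior w → code u < code w → code v ≤ code w)
    {y : V} (hy : y ≠ r) (hyu : R.top (R.parentEdge y) = u) : code v ≤ code y := by
  by_contra! hlt
  have hpos := (X.isInterior_iff.1 hv).trans_le (C.le_of_lt y v hlt)
  have hsucc := R.dist_eq_dist_parent_succ hy
  rw [hyu] at hsucc
  exact hlt.not_ge (hnext y (X.isInterior_iff.2 hpos) (C.lt_of_dist_lt u y (by omega)))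

/- Otherwise the last child edge of `u` could be shifted to the next interior vertex `v`. -/
theorem degree_eq_of_next (X : G.IsExtremal k d c f) (C : R.IsSpiralCode f code) {u v : V}
    (hu : G.IsInterior u) (hv : G.IsInterior v) (huv : code u < code v)
    (hnext : ∀ w, G.IsInterior w → code u < code w → code v ≤ code w) : G.degree u = d := by
  by_contra hne
  have hdeg : d < G.degree u := (X.le_degree u hu).lt_of_ne' hne
  obtain ⟨w, hw, rfl, hlast⟩ := X.exists_last_child R code (X.isInterior_iff.1 hu)
  set e := R.parentEdge w
  have he : e ∈ G.edges := R.parentEdge_mem w hw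
  have hchild : ∀ y, y ≠ r → R.top (R.parentEdge y) = R.top e → code v ≤ code y :=
    fun y hy hyu => X.code_le_of_top_eq C hv hnext hy hyu
  obtain ⟨e', he', htop', hne'⟩ := R.exists_top_eq_ne (X.two_le_degree.trans_lt hdeg) e
  obtain ⟨y, hy, hyt⟩ := X.exists_mem_ne he' (R.top e')
  have hyr := R.ne_root_of_ne_top he' hy hyt
  have hpy := R.eq_parentEdge e' he' y hy hyt
  have hve : v ∉ e := by
    intro hve
    have hvt : v ≠ R.top e := fun h => huv.ne (congrArg code h.symm)
    have hvr := R.ne_root_of_ne_top he hve hvt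
    have hpv := R.eq_parentEdge e he v hve hvt
    have hyv : y ≠ v := fun h => hne' (by rw [hpy, hpv, h])
    have hyw : y ≠ w := fun h => hne' (by rw [hpy, h])
    have hvy : code v < code y :=
      (hchild y hyr (by rw [← hpy, htop'])).lt_of_ne' (C.injective.ne hyv)
    have hyw : code y < code w :=
      (hlast y hyr (by rw [← hpy, htop'])).lt_of_ne (C.injective.ne hyw)
    exact hne' (by rw [hpy, hpv, C.parentEdge_eq v y w hvr hyr hw hpv.symm hvy hyw])
  refine X.ne_last_child C hu hw rfl hlast (X.eq_of_shiftable
    (R.shiftable hw hve (C.dist_le_of_le (hchild w hw rfl))) hdeg (X.isInterior_iff.1 hv)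
    (C.le_of_lt _ _ huv) (fun x hx hxt => ?_) (R.mem_parentEdge w hw))
  refine C.le_of_le (hchild x (R.ne_root_of_ne_top he hx hxt) ?_)
  rw [← R.eq_parentEdge e he x hx hxt]

theorem degree_eq_of_lt (X : G.IsExtremal k d c f) (C : R.IsSpiralCode f code) {u v : V}
    (hu : G.IsInterior u) (hv : G.IsInterior v) (huv : code u < code v) : G.degree u = d := by
  classical
  obtain ⟨w, hw, hnext⟩ := (Finset.univ.filter fun w =>
    G.IsInterior w ∧ code u < code w).exists_min_image code ⟨v, by simp [hv, huv]⟩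
  simp only [Finset.mem_filter, Finset.mem_univ, true_and] at hw hnext
  exact X.degree_eq_of_next C hu hw.1 hw.2 fun x hx hux => hnext x ⟨hx, hux⟩

theorem isSLOrdering (X : G.IsExtremal k d c f) (C : R.IsSpiralCode f code) :
    G.IsSLOrdering r fun u v => code u < code v where
  wellOrder := RelEmbedding.isWellOrder (⟨⟨code, C.injective⟩, Iff.rfl⟩ :
    (fun u v : V => code u < code v) ↪r ((· < ·) : ℕ → ℕ → Prop))
  height_le _ _ huv := C.dist_le_of_le huv.le
  children u v u₁ v₁ hu hv huv := by
    obtain ⟨hu₁, rfl⟩ := R.isParent_iff.1 hu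
    obtain ⟨hv₁, rfl⟩ := R.isParent_iff.1 hv
    exact C.children u₁ v₁ hu₁ hv₁ huv
  boundary u v huv hu := by
    by_contra hv
    have hle := C.le_of_lt u v huv
    rw [X.ground.zero u hu] at hle
    exact hle.not_gt (X.ground.pos v hv)
  edge_consecutive := by
    rintro e he a ha b hb c hc hab - ⟨v, hv, hbv, hvc⟩
    exact hv (C.edge_consecutive he ha hb hc hab hbv hvc)
  degree_le u v hu hv huv := by
    rw [X.degree_eq_of_lt C hu hv huv]
    exact X.le_degree v hv

theorem atMostOneInteriorDegreeGT (X : G.IsExtremal k d c f) (C : R.IsSpiralCode f code) :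
    G.AtMostOneInteriorDegreeGT d := by
  refine ⟨Finset.card_le_one.2 fun a ha b hb => C.injective ?_, fun v hv hd => ?_⟩
  · simp only [Finset.mem_filter, Finset.mem_univ, true_and] at ha hb
    rcases lt_trichotomy (code a) (code b) with hlt | heq | hlt
    · exact absurd (X.degree_eq_of_lt C ha.1 hb.1 hlt) ha.2.ne'
    · exact heq
    · exact absurd (X.degree_eq_of_lt C hb.1 ha.1 hlt) hb.2.ne'
  · exact (X.le_degree v hv).antisymm' (not_lt.1 hd)

theorem exists_isSpiralCode (X : G.IsExtremal k d c f) :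
    ∃ (r : V) (R : G.Rooting r) (code : V → ℕ), R.IsSpiralCode f code := by
  obtain ⟨v, -⟩ := X.exists_interior
  have : Nonempty V := ⟨v⟩
  obtain ⟨r, hmax⟩ := Finite.exists_max f
  obtain ⟨R⟩ := X.supertree.nonempty_rooting r
  exact ⟨r, R, R.spiralCode f, X.isSpiralCode R hmax⟩

end IsExtremal

end SpiralOrder

section FaberKrahn

theorem HasFaberKrahn.exists_isExtremal {k n n₀ d : ℕ} (hk : 2 ≤ k) (hn₀ : 1 ≤ n₀) (hd : 2 ≤ d)
    {G : FinHypergraph (Fin n)} (hG : HasFaberKrahn (supertreesMinDegree k n n₀ d) G) :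
    ∃ c f, G.IsExtremal k d c f := by
  obtain ⟨⟨⟨hu, hs, hcard⟩, hdeg⟩, hmin⟩ := hG
  obtain ⟨v, hv⟩ : ∃ v, G.IsInterior v := by
    obtain ⟨v, hv⟩ := Finset.card_pos.1 (hn₀.trans_eq hcard.symm)
    exact ⟨v, (Finset.mem_filter.1 hv).2⟩
  obtain ⟨f, hf⟩ := hs.1.exists_isGroundState hu hk ⟨v, hv⟩
  refine ⟨_, f, hk, hd, hu, hs, hf, hdeg, ⟨v, hv⟩, fun H hH g hg => ?_⟩
  have hint : ∀ w, H.IsInterior w ↔ G.IsInterior w := fun w => not_congr (hH.isBoundary_iff w)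
  have hle : G.firstDirichletEigenvalue ≤ H.firstDirichletEigenvalue := by
    refine hmin H ⟨⟨hH.uniform, hH.supertree, ?_⟩, fun w hw => hH.le_degree w ((hint w).1 hw)⟩
    simp only [hint, ← hcard]
  obtain ⟨f', hf'⟩ := hH.supertree.1.exists_isGroundState hH.uniform hk ⟨v, (hint v).2 hv⟩
  refine le_trans ?_ (hf'.le_energy g fun w hw => hg w ((hH.isBoundary_iff w).1 hw))
  have hk' : (0 : ℝ) ≤ k - 1 := sub_nonneg.2 (by exact_mod_cast one_le_two.trans hk)
  exact mul_le_mul_of_nonneg_right (mul_le_mul_of_nonneg_left hle hk')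
    (Finset.sum_nonneg fun _ _ => sq_nonneg _)

end FaberKrahn

section Position

namespace Rooting

variable {V : Type*} {G : FinHypergraph V} {r : V} {R : G.Rooting r} {f : V → ℝ} {pos : V → ℕ}

namespace IsSpiralCode

theorem root_lt (C : R.IsSpiralCode f pos) {v : V} (hv : v ≠ r) : pos r < pos v := by
  refine C.lt_of_dist_lt r v ?_
  rw [(R.dist_eq_zero_iff r).2 rfl]
  exact Nat.pos_of_ne_zero fun h => hv ((R.dist_eq_zero_iff v).1 h)

theorem lt_of_parentEdge_eq (C : R.IsSpiralCode f pos) {u u' v v' : V} (hu : u ≠ r)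
    (hu' : u' ≠ r) (hv : v ≠ r) (hv' : v' ≠ r) (huu' : R.parentEdge u = R.parentEdge u')
    (hvv' : R.parentEdge v = R.parentEdge v') (hne : R.parentEdge u ≠ R.parentEdge v)
    (huv : pos u < pos v) : pos u' < pos v' := by
  have hu'v : pos u' < pos v := by
    by_contra! hle
    have hvu' : v ≠ u' := fun h => hne (huu'.trans (congrArg _ h.symm))
    exact hne (C.parentEdge_eq u v u' hu hv hu' huu' huv (hle.lt_of_ne (C.injective.ne hvu'))).symm
  by_contra! hle
  have hv'u' : v' ≠ u' := fun h => hne (huu'.trans (h ▸ hvv'.symm))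
  exact hne (huu'.trans ((C.parentEdge_eq v' u' v hv' hu' hv hvv'.symm
    (hle.lt_of_ne (C.injective.ne hv'u')) hu'v).trans hvv'.symm))

end IsSpiralCode

/-- The number of edges whose top vertex has one of the positions `0, …, i - 1`. -/
def topsBefore (R : G.Rooting r) (pos : V → ℕ) (i : ℕ) : ℕ :=
  (G.edges.filter fun e => pos (R.top e) < i).card

theorem topsBefore_mono (R : G.Rooting r) : Monotone (R.topsBefore pos) := fun _ _ hij =>
  Finset.card_le_card (Finset.monotone_filter_right _ fun _ _ h => h.trans_le hij)

variable [DecidableEq V]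

/-- The edges that come before the parent edge of `v`: those other than the parent edge that have
a member, not their top vertex, before `v`. -/
def edgesBefore (R : G.Rooting r) (pos : V → ℕ) (v : V) : Finset (Finset V) :=
  G.edges.filter fun e => e ≠ R.parentEdge v ∧ ∃ w ∈ e, w ≠ R.top e ∧ pos w < pos v

theorem mem_edgesBefore (R : G.Rooting r) {v : V} {e : Finset V} :
    e ∈ R.edgesBefore pos v ↔
      e ≠ R.parentEdge v ∧ ∃ w, w ≠ r ∧ R.parentEdge w = e ∧ pos w < pos v := by
  rw [edgesBefore, Finset.mem_filter]
  constructor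
  · rintro ⟨he, hne, w, hw, hwt, hlt⟩
    exact ⟨hne, w, R.ne_root_of_ne_top he hw hwt, (R.eq_parentEdge e he w hw hwt).symm, hlt⟩
  · rintro ⟨hne, w, hwr, rfl, hlt⟩
    exact ⟨R.parentEdge_mem w hwr, hne, w, R.mem_parentEdge w hwr, R.ne_top_parentEdge w hwr, hlt⟩

theorem card_filter_parentEdge_eq_lt [Fintype V] {k : ℕ} (R : G.Rooting r) (hu : G.IsUniform k)
    {v : V} (hv : v ≠ r) :
    ((Finset.univ.erase r).filter fun w =>
      R.parentEdge w = R.parentEdge v ∧ pos w < pos v).card < k - 1 := by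
  have hE := R.parentEdge_mem v hv
  rw [← hu _ hE, ← Finset.card_erase_of_mem (R.top_mem _ hE), ← R.filter_parentEdge_eq hE]
  exact Finset.card_lt_card (Finset.ssubset_iff_of_subset
    (Finset.monotone_filter_right _ fun _ _ h => h.1) |>.2 ⟨v, by simp [hv], by simp⟩)

theorem parentEdge_notMem_edgesBefore (R : G.Rooting r) (v : V) :
    R.parentEdge v ∉ R.edgesBefore pos v :=
  fun h => (R.mem_edgesBefore.1 h).1 rfl

namespace IsSpiralCode

theorem edgesBefore_subset (C : R.IsSpiralCode f pos) {u v : V} (hu : u ≠ r) (hv : v ≠ r)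
    (huv : R.parentEdge u = R.parentEdge v ∨ pos u < pos v) :
    R.edgesBefore pos u ⊆ R.edgesBefore pos v := by
  intro e he
  rw [R.mem_edgesBefore] at he ⊢
  obtain ⟨hne, w, hw, rfl, hlt⟩ := he
  rcases huv with huv | huv
  · exact ⟨huv ▸ hne, w, hw, rfl, C.lt_of_parentEdge_eq hw hw hu hv rfl huv hne hlt⟩
  · exact ⟨fun h => hne (C.parentEdge_eq w u v hw hu hv h hlt huv).symm, w, hw, rfl, hlt.trans huv⟩

theorem card_edgesBefore_lt (C : R.IsSpiralCode f pos) {u v : V} (hu : u ≠ r) (hv : v ≠ r)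
    (hne : R.parentEdge u ≠ R.parentEdge v) (huv : pos u < pos v) :
    (R.edgesBefore pos u).card < (R.edgesBefore pos v).card :=
  Finset.card_lt_card (Finset.ssubset_iff_of_subset (C.edgesBefore_subset hu hv (.inr huv)) |>.2
    ⟨_, R.mem_edgesBefore.2 ⟨hne, u, hu, rfl, huv⟩, R.parentEdge_notMem_edgesBefore u⟩)

theorem parentEdge_eq_iff (C : R.IsSpiralCode f pos) {u v : V} (hu : u ≠ r) (hv : v ≠ r) :
    R.parentEdge u = R.parentEdge v ↔
      (R.edgesBefore pos u).card = (R.edgesBefore pos v).card := by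
  refine ⟨fun huv => ?_, fun hcard => by_contra fun hne => ?_⟩
  · rw [(C.edgesBefore_subset hu hv (.inl huv)).antisymm
      (C.edgesBefore_subset hv hu (.inl huv.symm))]
  · rcases lt_trichotomy (pos u) (pos v) with hlt | heq | hlt
    · exact (C.card_edgesBefore_lt hu hv hne hlt).ne hcard
    · exact hne (congrArg R.parentEdge (C.injective heq))
    · exact (C.card_edgesBefore_lt hv hu (Ne.symm hne) hlt).ne hcard.symm

variable {k : ℕ}

theorem topsBefore_le (C : R.IsSpiralCode f pos) (hk : 2 ≤ k) (hu : G.IsUniform k) {v : V}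
    (hv : v ≠ r) :
    R.topsBefore pos (pos (R.top (R.parentEdge v))) ≤ (R.edgesBefore pos v).card := by
  refine Finset.card_le_card fun e he => ?_
  obtain ⟨he, hlt⟩ := Finset.mem_filter.1 he
  obtain ⟨w, hw, hwt⟩ := Finset.exists_mem_ne (hk.trans_eq (hu e he).symm) (R.top e)
  have hwr := R.ne_root_of_ne_top he hw hwt
  obtain rfl := R.eq_parentEdge e he w hw hwt
  exact R.mem_edgesBefore.2 ⟨fun h => (h ▸ hlt).false, w, hwr, rfl, C.children w v hwr hv hlt⟩

theorem lt_topsBefore (C : R.IsSpiralCode f pos) {v : V} (hv : v ≠ r) :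
    (R.edgesBefore pos v).card < R.topsBefore pos (pos (R.top (R.parentEdge v)) + 1) := by
  refine Finset.card_lt_card (Finset.ssubset_iff_of_subset (fun e he => ?_) |>.2
    ⟨R.parentEdge v, ?_, R.parentEdge_notMem_edgesBefore v⟩)
  · obtain ⟨-, w, hw, rfl, hlt⟩ := R.mem_edgesBefore.1 he
    refine Finset.mem_filter.2 ⟨R.parentEdge_mem w hw, Nat.lt_succ_of_le ?_⟩
    exact not_lt.1 fun h => (C.children v w hv hw h).not_gt hlt
  · exact Finset.mem_filter.2 ⟨R.parentEdge_mem v hv, Nat.lt_succ_self _⟩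

variable [Fintype V]

theorem card_filter_of_mem_edgesBefore (C : R.IsSpiralCode f pos) (hu : G.IsUniform k) {v : V}
    (hv : v ≠ r) {e : Finset V} (he : e ∈ R.edgesBefore pos v) :
    ((Finset.univ.erase r).filter fun w => R.parentEdge w = e ∧ pos w < pos v).card = k - 1 := by
  obtain ⟨hne, w, hw, rfl, hlt⟩ := R.mem_edgesBefore.1 he
  have hE := R.parentEdge_mem w hw
  rw [← hu _ hE, ← Finset.card_erase_of_mem (R.top_mem _ hE), ← R.filter_parentEdge_eq hE]
  congr 1
  refine Finset.filter_congr fun x hx => and_iff_left_of_imp fun hxw => ?_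
  exact C.lt_of_parentEdge_eq hw (Finset.ne_of_mem_erase hx) hv hv hxw.symm rfl hne hlt

/- The vertices other than the root are grouped into blocks of `k - 1` by their parent edges. -/
theorem div_eq_card_edgesBefore (C : R.IsSpiralCode f pos) (hu : G.IsUniform k) {v : V}
    (hv : v ≠ r) (hpos : (Finset.univ.filter fun w => pos w < pos v).card = pos v) :
    (pos v - 1) / (k - 1) = (R.edgesBefore pos v).card := by
  have hcard : ((Finset.univ.erase r).filter fun w => pos w < pos v).card = pos v - 1 := by
    rw [Finset.filter_erase, Finset.card_erase_of_mem (by simpa using C.root_lt hv), hpos]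
  have hmaps : ∀ w ∈ (Finset.univ.erase r).filter fun w => pos w < pos v,
      R.parentEdge w ∈ insert (R.parentEdge v) (R.edgesBefore pos v) := by
    intro w hw
    obtain ⟨hwr, hlt⟩ := Finset.mem_filter.1 hw
    rw [Finset.mem_insert, or_iff_not_imp_left, R.mem_edgesBefore]
    exact fun hne => ⟨hne, w, Finset.ne_of_mem_erase hwr, rfl, hlt⟩
  have hlast := R.card_filter_parentEdge_eq_lt (pos := pos) hu hv
  have hsum := Finset.card_eq_sum_card_fiberwise hmaps
  simp only [Finset.sum_insert (R.parentEdge_notMem_edgesBefore v), Finset.filter_filter,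
    and_comm (a := pos _ < pos v)] at hsum
  rw [Finset.sum_congr rfl fun e he => C.card_filter_of_mem_edgesBefore hu hv he, Finset.sum_const,
    smul_eq_mul, hcard] at hsum
  rw [hsum, Nat.add_mul_div_right _ _ (by omega), Nat.div_eq_of_lt hlast, zero_add]

end IsSpiralCode

theorem card_filter_top_eq (R : G.Rooting r) (v : V) :
    (G.edges.filter fun e => R.top e = v).card + (if v = r then 0 else 1) = G.degree v := by
  split_ifs with hv
  · rw [add_zero, degree]
    congr 1
    refine Finset.filter_congr fun e he => ⟨fun h => h ▸ R.top_mem e he, fun hve => ?_⟩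
    by_contra hne
    exact R.ne_root_of_ne_top he hve (Ne.symm hne) hv
  · have hset : (G.edges.filter fun e => v ∈ e) =
        insert (R.parentEdge v) (G.edges.filter fun e => R.top e = v) := by
      ext e
      rw [Finset.mem_insert, Finset.mem_filter, Finset.mem_filter]
      constructor
      · rintro ⟨he, hve⟩
        exact or_iff_not_imp_left.2 fun hp => ⟨he, (R.eq_top_of_ne_parentEdge he hve hp).symm⟩
      · rintro (rfl | ⟨he, rfl⟩)
        · exact ⟨R.parentEdge_mem v hv, R.mem_parentEdge v hv⟩
        · exact ⟨he, R.top_mem e he⟩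
    rw [degree, hset, Finset.card_insert_of_notMem]
    exact fun h => R.ne_top_parentEdge v hv (Finset.mem_filter.1 h).2.symm

theorem topsBefore_succ (R : G.Rooting r) (hpos : Function.Injective pos) (v : V) :
    R.topsBefore pos (pos v + 1) + (if v = r then 0 else 1) =
      R.topsBefore pos (pos v) + G.degree v := by
  rw [← R.card_filter_top_eq, ← add_assoc, topsBefore, topsBefore,
    ← Finset.card_union_of_disjoint, ← Finset.filter_or]
  · simp only [Nat.lt_succ_iff_lt_or_eq, hpos.eq_iff]
  · rw [Finset.disjoint_filter]
    rintro e _ hlt rfl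
    exact hlt.false

end Rooting

end Position

section EquivFin

variable {α : Type*}

theorem card_filter_equivFin_lt [Fintype α] {N : ℕ} (π : α ≃ Fin N) (a : α) :
    (Finset.univ.filter fun b => (π b : ℕ) < π a).card = π a := by
  rw [← Fin.card_Iio (π a)]
  exact Finset.card_equiv π fun b => by simp

theorem exists_equivFin_eq {N : ℕ} (π : α ≃ Fin N) {s : Finset α} {i : ℕ} (hi : i < s.card) :
    ∃ a, (π a : ℕ) = i := by
  have hN : s.card ≤ N := by simpa using Finset.card_le_univ (s.map π.toEmbedding)
  obtain ⟨a, ha⟩ := π.surjective ⟨i, hi.trans_le hN⟩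
  exact ⟨a, congrArg Fin.val ha⟩

theorem exists_equivFin_lt_iff [Fintype α] (s : α → α → Prop) [IsStrictTotalOrder α s] :
    ∃ π : α ≃ Fin (Fintype.card α), ∀ a b, π a < π b ↔ s a b := by
  classical
  let := linearOrderOfSTO s
  exact ⟨(Fintype.orderIsoFinOfCardEq α rfl).symm.toEquiv,
    fun _ _ => (Fintype.orderIsoFinOfCardEq α rfl).symm.lt_iff_lt⟩

end EquivFin

section Unique

namespace Rooting

variable {V W : Type*} {G : FinHypergraph V} {H : FinHypergraph W} {r : V} {s : W}

theorem mem_parentEdge_iff (R : G.Rooting r) {u v : V} (hv : v ≠ r) :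
    u ∈ R.parentEdge v ↔
      u = R.top (R.parentEdge v) ∨ u ≠ r ∧ R.parentEdge u = R.parentEdge v := by
  have he := R.parentEdge_mem v hv
  constructor
  · exact fun hu => or_iff_not_imp_left.2 fun hut =>
      ⟨R.ne_root_of_ne_top he hu hut, (R.eq_parentEdge _ he u hu hut).symm⟩
  · rintro (rfl | ⟨hu, heq⟩)
    · exact R.top_mem _ he
    · exact heq ▸ R.mem_parentEdge u hu

theorem map_parentEdge (R : G.Rooting r) (S : H.Rooting s) (σ : V ≃ W) (hroot : σ r = s)
    (htop : ∀ v, v ≠ r → σ (R.top (R.parentEdge v)) = S.top (S.parentEdge (σ v)))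
    (hparent : ∀ u v, u ≠ r → v ≠ r →
      (R.parentEdge u = R.parentEdge v ↔ S.parentEdge (σ u) = S.parentEdge (σ v)))
    {v : V} (hv : v ≠ r) : (R.parentEdge v).map σ.toEmbedding = S.parentEdge (σ v) := by
  subst hroot
  ext w
  obtain ⟨u, rfl⟩ := σ.surjective w
  rw [Finset.mem_map_equiv, σ.symm_apply_apply, R.mem_parentEdge_iff hv,
    S.mem_parentEdge_iff (σ.injective.ne hv), ← htop v hv, σ.injective.eq_iff, σ.injective.ne_iff]
  exact or_congr_right (and_congr_right fun hu => hparent u v hu hv)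

theorem isomorphic (R : G.Rooting r) (S : H.Rooting s) (σ : V ≃ W) (hroot : σ r = s)
    (htop : ∀ v, v ≠ r → σ (R.top (R.parentEdge v)) = S.top (S.parentEdge (σ v)))
    (hparent : ∀ u v, u ≠ r → v ≠ r →
      (R.parentEdge u = R.parentEdge v ↔ S.parentEdge (σ u) = S.parentEdge (σ v)))
    (hG : ∀ e ∈ G.edges, 1 < e.card) (hH : ∀ e ∈ H.edges, 1 < e.card) : G.Isomorphic H := by
  have hmap := fun v => R.map_parentEdge S σ hroot htop hparent (v := v)
  refine ⟨σ, fun e => ⟨fun he => ?_, fun he => ?_⟩⟩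
  · obtain ⟨w, hw, hwt⟩ := Finset.exists_mem_ne (hH _ he) (S.top (e.map σ.toEmbedding))
    have hws := S.ne_root_of_ne_top he hw hwt
    have heq := S.eq_parentEdge _ he w hw hwt
    obtain ⟨v, rfl⟩ := σ.surjective w
    have hv : v ≠ r := fun h => hws (h ▸ hroot)
    rw [← hmap v hv, Finset.map_inj] at heq
    exact heq ▸ R.parentEdge_mem v hv
  · obtain ⟨v, hv, hvt⟩ := Finset.exists_mem_ne (hG e he) (R.top e)
    have hvr := R.ne_root_of_ne_top he hv hvt
    rw [R.eq_parentEdge e he v hv hvt, hmap v hvr]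
    exact S.parentEdge_mem _ fun h => hvr (σ.injective (h.trans hroot.symm))

variable {R : G.Rooting r} {S : H.Rooting s} {f : V → ℝ}
  {g : W → ℝ} {k N : ℕ} {π : V ≃ Fin N} {ρ : W ≃ Fin N}

theorem IsSpiralCode.equivFin_root (C : R.IsSpiralCode f fun v => (π v : ℕ)) :
    (π r : ℕ) = 0 := by
  obtain ⟨v, hv⟩ := π.surjective ⟨0, (π r).pos⟩
  have hv : (π v : ℕ) = 0 := congrArg Fin.val hv
  by_contra hr
  have := C.root_lt (ne_of_apply_ne (fun v => (π v : ℕ)) (hv.trans_ne (Ne.symm hr)))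
  omega

/- The position of a vertex determines its block, and the block determines the parent, because
the intervals from `topsBefore i` to `topsBefore (i + 1)` are disjoint. -/
theorem IsSpiralCode.isomorphic (C : R.IsSpiralCode f fun v => (π v : ℕ))
    (D : S.IsSpiralCode g fun w => (ρ w : ℕ)) (hk : 2 ≤ k) (hG : G.IsUniform k)
    (hH : H.IsUniform k)
    (htops : R.topsBefore (fun v => (π v : ℕ)) = S.topsBefore fun w => (ρ w : ℕ)) :
    G.Isomorphic H := by
  classical
  have : Fintype V := Fintype.ofEquiv _ π.symm
  have : Fintype W := Fintype.ofEquiv _ ρ.symm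
  let σ : V ≃ W := π.trans ρ.symm
  have hσ : ∀ v, ρ (σ v) = π v := fun v => ρ.apply_symm_apply (π v)
  have hroot : σ r = s := ρ.injective (Fin.ext (by rw [hσ, C.equivFin_root, D.equivFin_root]))
  have hne : ∀ v, v ≠ r → σ v ≠ s := fun v hv => hroot ▸ σ.injective.ne hv
  have hblock : ∀ v, v ≠ r → (S.edgesBefore (fun w => (ρ w : ℕ)) (σ v)).card =
      (R.edgesBefore (fun v => (π v : ℕ)) v).card := by
    intro v hv
    rw [← C.div_eq_card_edgesBefore hG hv (card_filter_equivFin_lt π v),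
      ← D.div_eq_card_edgesBefore hH (hne v hv) (card_filter_equivFin_lt ρ _), hσ]
  refine R.isomorphic S σ hroot (fun v hv => ?_) (fun u v hu hv => ?_)
    (fun e he => hk.trans_eq (hG e he).symm) (fun e he => hk.trans_eq (hH e he).symm)
  · have hlow := C.topsBefore_le hk hG hv
    have hup := C.lt_topsBefore hv
    have hlow' := D.topsBefore_le hk hH (hne v hv)
    have hup' := D.lt_topsBefore (hne v hv)
    rw [hblock v hv, ← htops] at hlow' hup'
    refine ρ.injective (Fin.ext ?_)
    rw [hσ]
    exact le_antisymm (Nat.le_of_lt_succ (R.topsBefore_mono.reflect_lt (hlow.trans_lt hup')))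
      (Nat.le_of_lt_succ (R.topsBefore_mono.reflect_lt (hlow'.trans_lt hup)))
  · rw [C.parentEdge_eq_iff hu hv, D.parentEdge_eq_iff (hne u hu) (hne v hv), hblock u hu,
      hblock v hv]

end Rooting

end Unique

section SLOrdering

variable {V : Type*} [DecidableEq V] {G : FinHypergraph V} {r : V} {lt : V → V → Prop}

namespace IsSLOrdering

theorem isSpiralCode (O : G.IsSLOrdering r lt) (R : G.Rooting r) {pos : V → ℕ}
    (hinj : Function.Injective pos) (hpos : ∀ u v, pos u < pos v ↔ lt u v) :
    R.IsSpiralCode 0 pos := by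
  have hdist : ∀ u v, G.dist u r < G.dist v r → pos u < pos v := fun u v h => by
    refine lt_of_not_ge fun hle => ?_
    have hne : pos v ≠ pos u := hinj.ne fun hvu => (hvu ▸ h).false
    exact (O.height_le v u ((hpos v u).1 (hle.lt_of_ne hne))).not_gt h
  refine ⟨hinj, hdist, fun _ _ _ => le_rfl, fun u v hu hv h => ?_,
    fun u v w hu _ hw huw huv hvw => ?_⟩
  · rw [hpos] at h ⊢
    exact O.children _ _ u v (R.isParent_iff.2 ⟨hu, rfl⟩) (R.isParent_iff.2 ⟨hv, rfl⟩) h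
  · have he := R.parentEdge_mem u hu
    have htop : pos (R.top (R.parentEdge u)) < pos u :=
      hdist _ _ (by rw [R.dist_eq_dist_parent_succ hu]; exact Nat.lt_succ_self _)
    have hmem : v ∈ R.parentEdge u := by
      by_contra hmem
      simp only [hpos] at htop huv hvw
      have := O.wellOrder
      exact O.edge_consecutive _ he _ (R.top_mem _ he) u (R.mem_parentEdge u hu) w
        (huw ▸ R.mem_parentEdge w hw) htop (_root_.trans huv hvw) ⟨v, hmem, huv, hvw⟩
    exact (R.eq_parentEdge _ he v hmem (ne_of_apply_ne pos (htop.trans huv).ne')).symm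

variable {N : ℕ} {π : V ≃ Fin N}

theorem isSpiralCode_equivFin (O : G.IsSLOrdering r lt) (R : G.Rooting r)
    (hπ : ∀ u v, π u < π v ↔ lt u v) : R.IsSpiralCode 0 fun v => (π v : ℕ) :=
  O.isSpiralCode R (Fin.val_injective.comp π.injective) hπ

variable [Fintype V] {n₀ d : ℕ}

theorem isInterior_iff (O : G.IsSLOrdering r lt) (hπ : ∀ u v, π u < π v ↔ lt u v)
    (hcard : (Finset.univ.filter fun v => G.IsInterior v).card = n₀) {v : V} :
    G.IsInterior v ↔ (π v : ℕ) < n₀ := by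
  classical
  rw [← hcard, ← card_filter_equivFin_lt π v]
  simp only [Fin.val_fin_lt, hπ]
  constructor
  · intro hv
    have := O.wellOrder
    refine Finset.card_lt_card (Finset.ssubset_iff_of_subset
      (Finset.monotone_filter_right _ fun w _ hwv hw => ?_) |>.2 ⟨v, by simpa, by simp [irrefl]⟩)
    exact hv (O.boundary w v hwv hw)
  · contrapose!
    intro hv
    refine Finset.card_le_card (Finset.monotone_filter_right _ fun w _ hw => ?_)
    by_contra hwv
    rw [← hπ, not_lt] at hwv
    rcases hwv.lt_or_eq with hlt | heq
    · exact hw (O.boundary v w ((hπ v w).1 hlt) (not_not.1 hv))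
    · exact hv (π.injective heq ▸ hw)

theorem degree_eq (O : G.IsSLOrdering r lt) (hπ : ∀ u v, π u < π v ↔ lt u v)
    (hcard : (Finset.univ.filter fun v => G.IsInterior v).card = n₀)
    (hD : G.AtMostOneInteriorDegreeGT d) {v : V} (hv : π v + 1 < n₀) : G.degree v = d := by
  obtain ⟨w, hw⟩ := exists_equivFin_eq π (hcard.symm ▸ (by omega : n₀ - 1 < n₀))
  have hvi := (O.isInterior_iff hπ hcard (v := v)).2 (by omega)
  have hwi := (O.isInterior_iff hπ hcard (v := w)).2 (by omega)
  refine hD.2 v hvi fun hlt => ?_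
  have hle := O.degree_le v w hvi hwi ((hπ v w).1 (by rw [Fin.lt_def]; omega))
  have hvw := Finset.card_le_one.1 hD.1 v (by simp [hvi, hlt]) w (by simp [hwi, hlt.trans_le hle])
  rw [hvw] at hv
  omega

theorem topsBefore_eq_of_lt (O : G.IsSLOrdering r lt) (R : G.Rooting r)
    (hπ : ∀ u v, π u < π v ↔ lt u v)
    (hcard : (Finset.univ.filter fun v => G.IsInterior v).card = n₀) (hd : 1 ≤ d)
    (hD : G.AtMostOneInteriorDegreeGT d) {i : ℕ} (hi : i < n₀) :
    R.topsBefore (fun v => (π v : ℕ)) i = i * (d - 1) + (if i = 0 then 0 else 1) := by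
  induction i with
  | zero => simp [Rooting.topsBefore]
  | succ i ih =>
    obtain ⟨v, rfl⟩ := exists_equivFin_eq π (hcard.symm ▸ (Nat.lt_succ_self i).trans hi)
    have C := O.isSpiralCode_equivFin R hπ
    have hroot : v = r ↔ (π v : ℕ) = 0 := by
      rw [← C.equivFin_root, ← C.injective.eq_iff]
    have hsucc := R.topsBefore_succ C.injective v
    rw [O.degree_eq hπ hcard hD hi, ih (Nat.lt_of_succ_lt hi)] at hsucc
    simp only [hroot] at hsucc
    rw [add_mul, one_mul, if_neg (Nat.succ_ne_zero _)]
    split_ifs at hsucc <;> omega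

theorem topsBefore_eq_of_le (O : G.IsSLOrdering r lt) (R : G.Rooting r)
    (hπ : ∀ u v, π u < π v ↔ lt u v)
    (hcard : (Finset.univ.filter fun v => G.IsInterior v).card = n₀) (hn₀ : 0 < n₀) {i : ℕ}
    (hi : n₀ ≤ i) : R.topsBefore (fun v => (π v : ℕ)) i = G.edges.card := by
  have hr := (O.isInterior_iff hπ hcard).2
    ((O.isSpiralCode_equivFin R hπ).equivFin_root.trans_lt hn₀)
  rw [Rooting.topsBefore, Finset.filter_true_of_mem]
  exact fun e he => ((O.isInterior_iff hπ hcard).1 (R.isInterior_top hr he)).trans_le hi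

end IsSLOrdering

end SLOrdering

section Main

variable {k n n₀ d : ℕ}

theorem isomorphic_of_hasSLOrdering (hk : 2 ≤ k) (hn₀ : 0 < n₀) (hd : 1 ≤ d)
    {G H : FinHypergraph (Fin n)} (hG : G ∈ supertrees k n n₀) (hH : H ∈ supertrees k n n₀)
    (hGO : G.HasSLOrdering) (hGD : G.AtMostOneInteriorDegreeGT d) (hHO : H.HasSLOrdering)
    (hHD : H.AtMostOneInteriorDegreeGT d) : G.Isomorphic H := by
  obtain ⟨⟨hGu, hGs, hGc⟩, hHu, hHs, hHc⟩ := And.intro hG hH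
  obtain ⟨⟨r, ltG, OG⟩, s, ltH, OH⟩ := And.intro hGO hHO
  have := OG.wellOrder
  have := OH.wellOrder
  obtain ⟨R⟩ := hGs.nonempty_rooting r
  obtain ⟨S⟩ := hHs.nonempty_rooting s
  obtain ⟨π, hπ⟩ := exists_equivFin_lt_iff ltG
  obtain ⟨ρ, hρ⟩ := exists_equivFin_lt_iff ltH
  have hedges : G.edges.card = H.edges.card := by
    have hcard := (hGs.card_eq_of_isUniform hGu).symm.trans (hHs.card_eq_of_isUniform hHu)
    exact Nat.eq_of_mul_eq_mul_right (by omega : 0 < k - 1) (Nat.add_left_cancel hcard)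
  refine (OG.isSpiralCode_equivFin R hπ).isomorphic (OH.isSpiralCode_equivFin S hρ) hk hGu hHu
    (funext fun i => ?_)
  rcases lt_or_ge i n₀ with hi | hi
  · rw [OG.topsBefore_eq_of_lt R hπ hGc hd hGD hi, OH.topsBefore_eq_of_lt S hρ hHc hd hHD hi]
  · rw [OG.topsBefore_eq_of_le R hπ hGc hn₀ hi, OH.topsBefore_eq_of_le S hρ hHc hn₀ hi, hedges]

theorem exists_hasFaberKrahn {V : Type*} [Fintype V] [DecidableEq V] {C : Set (FinHypergraph V)}
    (hC : C.Nonempty) : ∃ G, HasFaberKrahn C G := by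
  have : Finite (FinHypergraph V) :=
    Finite.of_injective FinHypergraph.edges fun _ _ => FinHypergraph.ext
  exact Set.exists_min_image C firstDirichletEigenvalue C.toFinite hC

theorem HasFaberKrahn.hasSLOrdering_and_atMostOneInteriorDegreeGT (hk : 2 ≤ k) (hn₀ : 1 ≤ n₀)
    (hd : 2 ≤ d) {G : FinHypergraph (Fin n)}
    (hG : HasFaberKrahn (supertreesMinDegree k n n₀ d) G) :
    G.HasSLOrdering ∧ G.AtMostOneInteriorDegreeGT d := by
  obtain ⟨c, f, X⟩ := hG.exists_isExtremal hk hn₀ hd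
  obtain ⟨r, R, code, C⟩ := X.exists_isSpiralCode
  exact ⟨⟨r, _, X.isSLOrdering C⟩, X.atMostOneInteriorDegreeGT C⟩

theorem AtMostOneInteriorDegreeGT.mem_supertreesMinDegree {G : FinHypergraph (Fin n)}
    (hD : G.AtMostOneInteriorDegreeGT d) (hG : G ∈ supertrees k n n₀) :
    G ∈ supertreesMinDegree k n n₀ d :=
  ⟨hG, fun v hv => (le_or_gt (G.degree v) d).elim (fun h => (hD.2 v hv h.not_gt).ge) le_of_lt⟩

theorem HasFaberKrahn.of_isomorphic {V : Type*} [Fintype V] [DecidableEq V]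
    {C : Set (FinHypergraph V)} {G H : FinHypergraph V} (hH : HasFaberKrahn C H) (hG : G ∈ C)
    (hGH : G.Isomorphic H) : HasFaberKrahn C G :=
  ⟨hG, fun K hK => hGH.firstDirichletEigenvalue_eq.trans_le (hH.2 K hK)⟩

end Main

end FinHypergraph

theorem mainTheorem2 (k n n₀ d : ℕ) (hk : 2 ≤ k) (hn₀ : 1 ≤ n₀) (hd : 2 ≤ d) :
    (∀ G ∈ FinHypergraph.supertrees k n n₀,
      (FinHypergraph.HasFaberKrahn (FinHypergraph.supertreesMinDegree k n n₀ d) G ↔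
        G.HasSLOrdering ∧ G.AtMostOneInteriorDegreeGT d)) ∧
    ((FinHypergraph.supertreesMinDegree k n n₀ d).Nonempty →
      ∃ G, FinHypergraph.HasFaberKrahn (FinHypergraph.supertreesMinDegree k n n₀ d) G) ∧
    (∀ G H, FinHypergraph.HasFaberKrahn (FinHypergraph.supertreesMinDegree k n n₀ d) G →
      FinHypergraph.HasFaberKrahn (FinHypergraph.supertreesMinDegree k n n₀ d) H →
      G.Isomorphic H) := by
  have hnec := fun G => FinHypergraph.HasFaberKrahn.hasSLOrdering_and_atMostOneInteriorDegreeGT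
    (n := n) (G := G) hk hn₀ hd
  have huniq := fun G H => FinHypergraph.isomorphic_of_hasSLOrdering (n := n) (G := G) (H := H)
    hk hn₀ (one_le_two.trans hd)
  refine ⟨fun G hG => ⟨hnec G, fun ⟨hO, hD⟩ => ?_⟩, FinHypergraph.exists_hasFaberKrahn,
    fun G H hG hH => ?_⟩
  · have hmem := hD.mem_supertreesMinDegree hG
    obtain ⟨H, hH⟩ := FinHypergraph.exists_hasFaberKrahn ⟨G, hmem⟩
    obtain ⟨hHO, hHD⟩ := hnec H hH
    exact hH.of_isomorphic hmem (huniq G H hG hH.1.1 hO hD hHO hHD)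
  · obtain ⟨hGO, hGD⟩ := hnec G hG
    obtain ⟨hHO, hHD⟩ := hnec H hH
    exact huniq G H hG.1.1 hH.1.1 hGO hGD hHO hHD
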